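/- Let $q$ be an indeterminate and work over $\mathbb C(q)$. Put $[n]=\frac{q^n-q^{-n}}{q-q^{-1}}$, $[n]!=[n][n-1]\cdots[1]$ and $\binom{n}{k}_q=\frac{[n]!}{[n-k]!\,[k]!}$ for $0\le k\le n$. Let $U_q(\mathfrak{gl}(2))$ be the unital algebra generated by $E,F,L_1^{\pm1},L_2^{\pm1}$ with $L_1L_2=L_2L_1$, $L_1E=qEL_1$, $L_2E=q^{-1}EL_2$, $L_1F=q^{-1}FL_1$, $L_2F=qFL_2$ and $EF-FE=\frac{K-K^{-1}}{q-q^{-1}}$, where $K=L_1L_2^{-1}$. Let $U'$ be obtained by adjoining elements $1_\mu$ ($\mu\in\mathbb Z^2$) with $1_\mu1_\nu=\delta_{\mu\nu}1_\mu$, $E1_\mu=1_{\mu+\alpha}E$, $F1_\mu=1_{\mu-\alpha}F$, $L_i1_\mu=q^{\mu_i}1_\mu$, where $\alpha=(1,-1)$, and let $\dot U=\dot U_q(\mathfrak{gl}(2))=\bigoplus_{\mu,\nu}1_\mu U'1_\nu$. Write $E^{(a)}=E^a/[a]!$, $F^{(a)}=F^a/[a]!$. For $K\ge 0$ let $I_{(K,0)}$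 be the two-sided ideal of $\dot U$ generated by all $1_\mu$ with $\mu$ not of the form $(a,b)$, $a,b\ge0$, $a+b=K$. For a dominant weight $\nu$ let $V_2(\nu)$ be the highest-weight module generated by a vector $v$ with $1_\nu v=v$, $L_iv=q^{\nu_i}v$, $Ev=0$, $F^{(\nu_1-\nu_2+1)}v=0$. Let $k,l,m$ be integers with $0\le m\le\min(k,l)$. The action of $\dot U$ on the modules $V_2(k+l-j,j)$, $0\le j\le (k+l)/2$, induces an isomorphism of algebras $$\Phi:\dot U/I_{(k+l,0)}\;\xrightarrow{\ \sim\ }\;\bigoplus_{0\le j\le (k+l)/2}\operatorname{End}_{\mathbb C(q)}\bigl(V_2(k+l-j,j)\bigr),$$ and the class in $\dot U/I_{(k+l,0)}$ of $$e^{k,l}_m=\sum_{t=0}^m(-1)^t\,\frac{\binom{l-m+t}{t}_q}{\binom{k+l-2m+t}{l-m+t}_q}\,\frac{[k+l-2m+1]}{[k+l-2m+1+t]}\,F^{(l-m+t)}E^{(l-m+t)}1_{(k,l)}$$ is the idempotent projecting to $\operatorname{End}_{\mathbb C(q)}(V_2(k+l-m,m))\cdot1_{(k,l)}$; that is, $e^{k,l}_m$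 is idempotent, its component under $\Phi$ in $\operatorname{End}_{\mathbb C(q)}(V_2(k+l-m,m))$ is the action of $1_{(k,l)}$, and its components in all other summands are $0$. -/

import Mathlib

noncomputable section

namespace QGL2

/-- The ground field `ℂ(q)`. -/
abbrev Cq : Type := RatFunc ℂ

/-- The indeterminate `q`. -/
def q : Cq := RatFunc.X

/-- The quantum integer `[n] = (q ^ n - q ^ (-n)) / (q - q ^ (-1))`. -/
def qInt (n : ℕ) : Cq := (q ^ (n : ℤ) - q ^ (-(n : ℤ))) / (q - q⁻¹)

/-- The quantum factorial `[n]! = [n] [n-1] ⋯ [1]`, where `[1] = 1`. -/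
def qFactorial (n : ℕ) : Cq := ∏ i ∈ Finset.range n, qInt (i + 1)

/-- The quantum binomial `[n]! / ([n-k]! [k]!)`, meaningful for `k ≤ n`. -/
def qBinom (n k : ℕ) : Cq := qFactorial n / (qFactorial (n - k) * qFactorial k)

/-- Weights of `gl(2)`. -/
abbrev Weight : Type := ℤ × ℤ

/-- The simple root `(1, -1)`. -/
def α : Weight := (1, -1)

/-- Generators of `U'_q(gl(2))`: those of `U_q(gl(2))` and one idempotent for every weight. -/
inductive Gen : Type
  | E | F | L₁ | L₁inv | L₂ | L₂inv
  | idem (μ : Weight)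

/-- A generator as an element of the free algebra. -/
abbrev g (x : Gen) : FreeAlgebra Cq Gen := FreeAlgebra.ι Cq x

open Gen in
/-- The defining relations: first those of `U_q(gl(2))` (with `K = L₁ L₂⁻¹`), then those of the
adjoined elements `1_μ`. -/
inductive Rel : FreeAlgebra Cq Gen → FreeAlgebra Cq Gen → Prop
  | L₁_mul_inv : Rel (g L₁ * g L₁inv) 1
  | L₁_inv_mul : Rel (g L₁inv * g L₁) 1
  | L₂_mul_inv : Rel (g L₂ * g L₂inv) 1
  | L₂_inv_mul : Rel (g L₂inv * g L₂) 1
  | L_comm : Rel (g L₁ * g L₂) (g L₂ * g L₁)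
  | L₁_E : Rel (g L₁ * g E) (q • (g E * g L₁))
  | L₂_E : Rel (g L₂ * g E) (q⁻¹ • (g E * g L₂))
  | L₁_F : Rel (g L₁ * g F) (q⁻¹ • (g F * g L₁))
  | L₂_F : Rel (g L₂ * g F) (q • (g F * g L₂))
  | E_F : Rel (g E * g F - g F * g E) ((q - q⁻¹)⁻¹ • (g L₁ * g L₂inv - g L₂ * g L₁inv))
  | idem_mul_self (μ : Weight) : Rel (g (idem μ) * g (idem μ)) (g (idem μ))
  | idem_mul_of_ne (μ ν : Weight) (h : μ ≠ ν) : Rel (g (idem μ) * g (idem ν)) 0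
  | E_idem (μ : Weight) : Rel (g E * g (idem μ)) (g (idem (μ + α)) * g E)
  | F_idem (μ : Weight) : Rel (g F * g (idem μ)) (g (idem (μ - α)) * g F)
  | L₁_idem (μ : Weight) : Rel (g L₁ * g (idem μ)) (q ^ μ.1 • g (idem μ))
  | L₂_idem (μ : Weight) : Rel (g L₂ * g (idem μ)) (q ^ μ.2 • g (idem μ))

/-- The algebra `U'_q(gl(2))`: `U_q(gl(2))` with the elements `1_μ` adjoined. -/
abbrev U' : Type := RingQuot Rel

/-- The image of a generator in `U'`. -/
def gen (x : Gen) : U' := RingQuot.mkAlgHom Cq Rel (g x)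

def E : U' := gen Gen.E
def F : U' := gen Gen.F
def L₁ : U' := gen Gen.L₁
def L₂ : U' := gen Gen.L₂

/-- The idempotent `1_μ`. -/
def one (μ : Weight) : U' := gen (Gen.idem μ)

/-- The divided power `E ^ a / [a]!`. -/
def Ediv (a : ℕ) : U' := (qFactorial a)⁻¹ • E ^ a

/-- The divided power `F ^ a / [a]!`. -/
def Fdiv (a : ℕ) : U' := (qFactorial a)⁻¹ • F ^ a

theorem one_mul_one_self (μ : Weight) : one μ * one μ = one μ := by
  simpa [one, gen] using RingQuot.mkAlgHom_rel Cq (Rel.idem_mul_self μ)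

theorem one_mul_one_of_ne {μ ν : Weight} (h : μ ≠ ν) : one μ * one ν = 0 := by
  simpa [one, gen] using RingQuot.mkAlgHom_rel Cq (Rel.idem_mul_of_ne μ ν h)

theorem E_mul_one (μ : Weight) : E * one μ = one (μ + α) * E := by
  simpa [one, gen, E] using RingQuot.mkAlgHom_rel Cq (Rel.E_idem μ)

theorem F_mul_one (μ : Weight) : F * one μ = one (μ - α) * F := by
  simpa [one, gen, F] using RingQuot.mkAlgHom_rel Cq (Rel.F_idem μ)

theorem E_pow_mul_one (a : ℕ) (μ : Weight) : E ^ a * one μ = one (μ + a • α) * E ^ a := by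
  induction a with
  | zero => simp
  | succ a ih =>
    rw [pow_succ', mul_assoc, ih, ← mul_assoc, E_mul_one, mul_assoc, add_assoc, succ_nsmul]

theorem F_pow_mul_one (a : ℕ) (μ : Weight) : F ^ a * one μ = one (μ - a • α) * F ^ a := by
  induction a with
  | zero => simp
  | succ a ih =>
    rw [pow_succ', mul_assoc, ih, ← mul_assoc, F_mul_one, mul_assoc, sub_sub, succ_nsmul]

/-- The linear span of the subspaces `1_μ U' 1_ν`; their sum is direct because the `1_μ` are
orthogonal idempotents. -/
def UdotSpan : Submodule Cq U' :=
  Submodule.span Cq {y | ∃ (μ ν : Weight) (x : U'), y = one μ * x * one ν}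

/-- The non-unital algebra `U̇_q(gl(2)) = ⨁ 1_μ U' 1_ν`. -/
def Udot : NonUnitalSubalgebra Cq U' where
  __ := UdotSpan
  mul_mem' := by
    intro a b ha hb
    change a ∈ UdotSpan at ha
    change b ∈ UdotSpan at hb
    change a * b ∈ UdotSpan
    have h := Submodule.mul_mem_mul ha hb
    rw [UdotSpan, Submodule.span_mul_span] at h
    refine Submodule.span_le.2 ?_ h
    rintro _ ⟨_, ⟨μ, ν, x, rfl⟩, _, ⟨μ', ν', y, rfl⟩, rfl⟩
    exact Submodule.subset_span ⟨μ, ν', x * one ν * (one μ' * y), by simp only [mul_assoc]⟩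

theorem one_mul_mul_one_mem (μ ν : Weight) (x : U') : one μ * x * one ν ∈ Udot :=
  Submodule.subset_span (s := {y | ∃ (μ ν : Weight) (x : U'), y = one μ * x * one ν})
    ⟨μ, ν, x, rfl⟩

theorem one_mem (μ : Weight) : one μ ∈ Udot := by
  simpa [one_mul_one_self] using one_mul_mul_one_mem μ μ 1

/-- `1_μ` as an element of `U̇`. -/
def oneDot (μ : Weight) : Udot := ⟨one μ, one_mem μ⟩

/-- `ν` is dominated by `lam`: the difference `lam - ν` is a non-negative integer multiple of
the simple root. -/
def Dominated (ν lam : Weight) : Prop := ∃ n : ℕ, lam - ν = n • α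

/-- `L(lam)`: the set of dominant weights `ν = (ν₁ ≥ ν₂)` that are dominated by `lam`. -/
def DomWeights (lam : Weight) : Set Weight := {ν | ν.2 ≤ ν.1 ∧ Dominated ν lam}

/-- The two-sided ideal `I_lam` of `U̇`, generated by those `1_μ` for which the dominant weight in
the Weyl group orbit `{(μ₁, μ₂), (μ₂, μ₁)}` is not dominated by `lam`. For `lam = (K, 0)` these
are the weights that are not of the form `(a, b)` with `a, b ≥ 0` and `a + b = K`. -/
def idealI (lam : Weight) : TwoSidedIdeal Udot :=
  TwoSidedIdeal.span {x | ∃ μ : Weight, (max μ.1 μ.2, min μ.1 μ.2) ∉ DomWeights lam ∧ x = oneDot μ}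

/-- The quotient `U̇_q(gl(2)) / I_lam`. -/
abbrev UdotMod (lam : Weight) : Type := (idealI lam).ringCon.Quotient

/-- The quotient map `U̇ → U̇ / I_lam`. -/
def toUdotMod (lam : Weight) (x : Udot) : UdotMod lam := (x : (idealI lam).ringCon.Quotient)

/-- The left ideal of relations of the highest weight vector `v` of weight `ν`:
`L_i v = q ^ ν_i v`, `E v = 0`, `F^(ν₁ - ν₂ + 1) v = 0` (a divided power), and `1_ν v = v`,
which says that the idempotents act by projection to the weight spaces. -/
def hwRelations (ν : Weight) : Submodule U' U' :=
  Submodule.span U' {L₁ - algebraMap Cq U' (q ^ ν.1), L₂ - algebraMap Cq U' (q ^ ν.2), E,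
    Fdiv (ν.1 - ν.2 + 1).toNat, one ν - 1}

/-- The highest weight module `V_2(ν)`, for a dominant weight `ν`. -/
abbrev V (ν : Weight) : Type := U' ⧸ hwRelations ν

/-- The element
`∑ t ≤ m, (-1)^t * [l-m+t choose t] / [k+l-2m+t choose l-m+t] * [k+l-2m+1] / [k+l-2m+1+t] *
F^(l-m+t) E^(l-m+t) 1_(k,l)`, for `m ≤ min k l`. -/
def projElt (k l m : ℕ) : U' :=
  ∑ t ∈ Finset.range (m + 1),
    ((-1) ^ t * (qBinom (l - m + t) t / qBinom (k + l - 2 * m + t) (l - m + t))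
        * (qInt (k + l - 2 * m + 1) / qInt (k + l - 2 * m + 1 + t))) •
      (Fdiv (l - m + t) * Ediv (l - m + t) * one ((k : ℤ), (l : ℤ)))

theorem projElt_mem (k l m : ℕ) : projElt k l m ∈ Udot := by
  refine sum_mem fun t _ => Udot.smul_mem' _ ?_
  set a := l - m + t
  set μ : Weight := ((k : ℤ), (l : ℤ))
  have h : F ^ a * E ^ a * one μ = one μ * (F ^ a * E ^ a) * one μ := by
    have h' : F ^ a * E ^ a * one μ = one μ * (F ^ a * E ^ a) := by
      rw [mul_assoc, E_pow_mul_one, ← mul_assoc, F_pow_mul_one, add_sub_cancel_right, mul_assoc]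
    rw [← h', mul_assoc _ (one μ), one_mul_one_self]
  have h2 : Fdiv a * Ediv a * one μ
      = ((qFactorial a)⁻¹ * (qFactorial a)⁻¹) • (one μ * (F ^ a * E ^ a) * one μ) := by
    rw [← h]
    simp only [Fdiv, Ediv, smul_mul_assoc, mul_smul_comm, mul_smul]
  rw [h2]
  exact Udot.smul_mem' _ (one_mul_mul_one_mem _ _ _)

/-- `projElt` as an element of `U̇`. -/
def projDot (k l m : ℕ) : Udot := ⟨projElt k l m, projElt_mem k l m⟩

end QGL2

end

noncomputable section

namespace QGL2

/-! Write `K = k + l`. In a highest weight module the vectors `F^(i) v` form a basis of weight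
vectors, and each `F^(a) E^(a)` acts on them by a product of two quantum binomials. On the weight
space `(k, l)` of `V_2(K - j, j)` this gives three cases (`IsHwVec.projElt_smul_basis`). For `j > m`
every term of `projElt` vanishes, since the power of `E` is too large. For `j = m` only `t = 0`
survives, with scalar 1. For `j < m` the scalar is a multiple of an alternating sum that telescopes
to 0 (`sum_alternating_eq_zero`).

These elements also yield the isomorphism. Multiplied by suitable `F^(i') E^(i)`, they give every
matrix unit of every summand, so the action is surjective (`exists_actHom_eq_single`). For
injectivity, reordering `E` and `F` shows that `U̇` is spanned modulo the ideal by as many elements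
as the target has dimensions (`Udot_le_span_sup`). By surjectivity their images are then a basis,
and the kernel is contained in the ideal (`mem_idealI_of_actHom_eq_zero`). Idempotence can be read
off in the target.

The modules enter only through `IsHwVec`. That the quotient `V ν` is non-zero is seen by mapping its
generator into a dual Verma module (`verma_hwRelations`). -/

/-! ### Quantum integers and the alternating sum. -/

theorem q_ne_zero : q ≠ 0 := RatFunc.X_ne_zero

theorem q_pow_ne_one {n : ℕ} (hn : n ≠ 0) : q ^ n ≠ 1 := by
  intro h
  have h1 : algebraMap (Polynomial ℂ) (RatFunc ℂ) (Polynomial.X ^ n)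
      = algebraMap (Polynomial ℂ) (RatFunc ℂ) 1 := by
    simpa [q, RatFunc.algebraMap_X] using h
  have h2 := congrArg Polynomial.natDegree (IsFractionRing.injective _ _ h1)
  simp at h2
  exact hn h2

/-- The quantum integer attached to an integer. -/
def qZ (z : ℤ) : Cq := (q ^ z - q ^ (-z)) / (q - q⁻¹)

theorem qInt_eq_qZ (n : ℕ) : qInt n = qZ n := rfl

theorem q_sub_inv_ne_zero : q - q⁻¹ ≠ 0 := by
  intro h
  refine q_pow_ne_one (n := 2) (by norm_num) ?_
  have : q = q⁻¹ := sub_eq_zero.1 h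
  rw [pow_two]
  nth_rewrite 1 [this]
  exact inv_mul_cancel₀ q_ne_zero

theorem qInt_ne_zero {n : ℕ} (hn : n ≠ 0) : qInt n ≠ 0 := by
  refine div_ne_zero ?_ q_sub_inv_ne_zero
  intro h
  refine q_pow_ne_one (n := 2 * n) (by omega) ?_
  have h1 : q ^ (n : ℤ) = q ^ (-(n : ℤ)) := sub_eq_zero.1 h
  rw [two_mul, pow_add]
  rw [zpow_neg, zpow_natCast] at h1
  nth_rewrite 1 [h1]
  exact inv_mul_cancel₀ (pow_ne_zero _ q_ne_zero)

theorem qZ_zero : qZ 0 = 0 := by simp [qZ]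

theorem qZ_one : qZ 1 = 1 := by
  simp [qZ, div_self q_sub_inv_ne_zero]

theorem qZ_neg (z : ℤ) : qZ (-z) = -qZ z := by
  rw [qZ, qZ, neg_neg, ← neg_div, neg_sub]

theorem qInt_zero : qInt 0 = 0 := by simp [qInt]

/-- The product of two quantum integers, in terms of powers of `q`. -/
theorem qZ_mul (a b : ℤ) : qZ a * qZ b
    = (q ^ (a + b) + q ^ (-(a + b)) - q ^ (a - b) - q ^ (b - a)) / (q - q⁻¹) ^ 2 := by
  rw [qZ, qZ, div_mul_div_comm, ← pow_two]
  congr 1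
  have e1 : q ^ (a + b) = q ^ a * q ^ b := zpow_add₀ q_ne_zero _ _
  have e2 : q ^ (-(a + b)) = q ^ (-a) * q ^ (-b) := by rw [← zpow_add₀ q_ne_zero]; congr 1; ring
  have e3 : q ^ (a - b) = q ^ a * q ^ (-b) := by rw [← zpow_add₀ q_ne_zero]; congr 1
  have e4 : q ^ (b - a) = q ^ (-a) * q ^ b := by rw [← zpow_add₀ q_ne_zero]; congr 1; ring
  rw [e1, e2, e3, e4]
  ring

/-- A factor `qZ 1 = 1` makes all terms quadratic, and `qZ_mul` then reduces the identity to
comparing exponents of `q`. This is the induction step for commuting `E` past a power of `F`. -/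
theorem qZ_add_mul (h a : ℤ) : qZ h + qZ a * qZ (h - a - 1) = qZ (a + 1) * qZ (h - a) := by
  have : qZ h = qZ h * qZ 1 := by rw [qZ_one, mul_one]
  rw [this, qZ_mul, qZ_mul, qZ_mul, ← add_div]
  congr 1
  ring_nf

theorem qZ_mul_sub_mul (h i : ℤ) : qZ (h - i) * qZ (i + 1) - qZ i * qZ (h - i + 1)
    = qZ (h - 2 * i) := by
  rw [← mul_one (qZ (h - 2 * i)), ← qZ_one, qZ_mul, qZ_mul, qZ_mul, ← sub_div]
  congr 1
  ring_nf

/-- The identity that makes the alternating sum telescope. -/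
theorem qZ_mul_add_mul (N d t : ℤ) : qZ (N + d + t + 1) * qZ (d - t) + qZ t * qZ (N + t + 1)
    = qZ d * qZ (N + d + 1) := by
  rw [qZ_mul, qZ_mul, qZ_mul, ← add_div]
  congr 1
  ring_nf

theorem qFactorial_zero : qFactorial 0 = 1 := by simp [qFactorial]

theorem qFactorial_succ (n : ℕ) : qFactorial (n + 1) = qFactorial n * qInt (n + 1) :=
  Finset.prod_range_succ _ _

theorem qFactorial_ne_zero (n : ℕ) : qFactorial n ≠ 0 :=
  Finset.prod_ne_zero_iff.2 fun _ _ => qInt_ne_zero (Nat.succ_ne_zero _)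

theorem qBinom_ne_zero (n k : ℕ) : qBinom n k ≠ 0 :=
  div_ne_zero (qFactorial_ne_zero _) (mul_ne_zero (qFactorial_ne_zero _) (qFactorial_ne_zero _))

/-- The partial sums of the alternating sum in `sum_alternating_eq_zero`. -/
theorem sum_alternating_partial (N d n : ℕ) (hn : n ≤ d) :
    (∑ t ∈ Finset.range n, (-1) ^ t * (qFactorial (N + d + t) /
      (qFactorial t * qFactorial (d - t) * qFactorial (N + t + 1)))) * (qInt d * qInt (N + d + 1))
    = -((-1) ^ n * (qFactorial (N + d + n) /
      (qFactorial n * qFactorial (d - n) * qFactorial (N + n + 1))) *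
        (qInt n * qInt (N + n + 1))) := by
  induction n with
  | zero => simp [qInt_zero]
  | succ n ih =>
    have h := qZ_mul_add_mul N d n
    rw [Finset.sum_range_succ, add_mul, ih (by omega)]
    obtain ⟨e, rfl⟩ : ∃ e, d = n + 1 + e := ⟨d - (n + 1), by omega⟩
    rw [show n + 1 + e - n = e + 1 by omega, show n + 1 + e - (n + 1) = e by omega,
      show N + (n + 1) + 1 = N + n + 1 + 1 by ring,
      show N + (n + 1 + e) + (n + 1) = N + (n + 1 + e) + n + 1 by ring,
      qFactorial_succ n, qFactorial_succ e, qFactorial_succ (N + n + 1),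
      qFactorial_succ (N + (n + 1 + e) + n)]
    have h' : qInt (N + (n + 1 + e) + n + 1) * qInt (e + 1) + qInt n * qInt (N + n + 1)
        = qInt (n + 1 + e) * qInt (N + (n + 1 + e) + 1) := by
      simp only [qInt_eq_qZ]
      rw [show ((n + 1 + e : ℕ) : ℤ) - n = ((e + 1 : ℕ) : ℤ) by push_cast; ring] at h
      simpa using h
    rw [← h', pow_succ]
    have h1 := qFactorial_ne_zero n
    have h2 := qFactorial_ne_zero e
    have h3 := qFactorial_ne_zero (N + n + 1)
    have h4 := qInt_ne_zero (n := n + 1) (by omega)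
    have h5 := qInt_ne_zero (n := e + 1) (by omega)
    have h6 := qInt_ne_zero (n := N + n + 1 + 1) (by omega)
    field_simp
    ring

theorem sum_alternating_eq_zero (N d : ℕ) (hd : d ≠ 0) :
    ∑ t ∈ Finset.range (d + 1), (-1) ^ t * (qFactorial (N + d + t) /
      (qFactorial t * qFactorial (d - t) * qFactorial (N + t + 1))) = 0 := by
  have h1 : qInt d * qInt (N + d + 1) ≠ 0 :=
    mul_ne_zero (qInt_ne_zero hd) (qInt_ne_zero (by omega))
  refine (mul_eq_zero.1 ?_).resolve_right h1
  -- At `n = d` the closed form of the partial sum is exactly minus the last term, times the common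
  -- factor.
  rw [Finset.sum_range_succ, add_mul, sum_alternating_partial N d d le_rfl]
  ring

/-- The scalar by which `projElt` with parameters `k = B + m`, `l = A + m` acts on the weight
space of weight `(k, l)` in the highest weight module of highest weight `(k + l - m + d, m - d)`. -/
theorem projElt_scalar_eq_zero (A B d : ℕ) (hd : d ≠ 0) :
    ∑ t ∈ Finset.range (d + 1),
      ((-1) ^ t * (qBinom (A + t) t / qBinom (A + B + t) (A + t))
        * (qInt (A + B + 1) / qInt (A + B + 1 + t)))
        * (qBinom (B + d + (A + t)) (A + t) * qBinom (A + d) (A + t)) = 0 := by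
  -- Both factors `[A+t]!` cancel and `[A+B+1+t]` completes `[A+B+t]!` to `[A+B+t+1]!`. What remains
  -- is the telescoping sum with `N = A + B`, times a factor independent of `t`.
  have key : ∀ t ∈ Finset.range (d + 1),
      ((-1) ^ t * (qBinom (A + t) t / qBinom (A + B + t) (A + t))
        * (qInt (A + B + 1) / qInt (A + B + 1 + t)))
        * (qBinom (B + d + (A + t)) (A + t) * qBinom (A + d) (A + t))
      = ((-1) ^ t * (qFactorial (A + B + d + t) /
          (qFactorial t * qFactorial (d - t) * qFactorial (A + B + t + 1)))) *
        (qFactorial B * qFactorial (A + d) * qInt (A + B + 1)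
          / (qFactorial A * qFactorial (B + d))) := by
    intro t ht
    have ht' : t ≤ d := Nat.lt_succ_iff.1 (Finset.mem_range.1 ht)
    simp only [qBinom]
    rw [show A + t - t = A by omega, show A + B + t - (A + t) = B by omega,
      show B + d + (A + t) - (A + t) = B + d by omega, show A + d - (A + t) = d - t by omega,
      show B + d + (A + t) = A + B + d + t by ring, qFactorial_succ (A + B + t),
      show A + B + 1 + t = A + B + t + 1 by ring]
    have h1 := qFactorial_ne_zero t
    have h2 := qFactorial_ne_zero A
    have h3 := qFactorial_ne_zero B
    have h4 := qFactorial_ne_zero (A + t)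
    have h5 := qFactorial_ne_zero (A + B + t)
    have h6 := qFactorial_ne_zero (B + d)
    have h7 := qFactorial_ne_zero (d - t)
    have h8 := qInt_ne_zero (n := A + B + t + 1) (by omega)
    field_simp
  rw [Finset.sum_congr rfl key, ← Finset.sum_mul, sum_alternating_eq_zero _ _ hd, zero_mul]

theorem projElt_scalar_eq_one (A B : ℕ) :
    qBinom A 0 / qBinom (A + B) A * (qInt (A + B + 1) / qInt (A + B + 1))
      * (qBinom (B + A) A * qBinom A A) = 1 := by
  have h1 := qFactorial_ne_zero A
  have h2 := qFactorial_ne_zero B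
  have h3 := qFactorial_ne_zero (A + B)
  have h4 := qInt_ne_zero (n := A + B + 1) (by omega)
  rw [add_comm B A]
  simp only [qBinom, Nat.sub_zero, Nat.sub_self, Nat.add_sub_cancel_left, qFactorial_zero]
  field_simp

/-! ### Commutation relations and spanning sets of `U' 1_ν`. -/

section Induction

variable {X : Type*} [AddCommGroup X] [Module Cq X] [Module U' X] [IsScalarTower Cq U' X]

/-- A subspace of a `U'`-module that is stable under the generators is stable under `U'`. -/
theorem smul_mem_of_gen (N : Submodule Cq X) (h : ∀ (x : Gen), ∀ y ∈ N, gen x • y ∈ N)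
    (u : U') {y : X} (hy : y ∈ N) : u • y ∈ N := by
  obtain ⟨a, rfl⟩ := RingQuot.mkAlgHom_surjective Cq Rel u
  induction a using FreeAlgebra.induction generalizing y with
  | grade0 r =>
    rw [AlgHom.commutes, algebraMap_smul]
    exact N.smul_mem _ hy
  | grade1 x => exact h x y hy
  | mul a b ha hb => rw [map_mul, mul_smul]; exact ha (hb hy)
  | add a b ha hb => rw [map_add, add_smul]; exact N.add_mem (ha hy) (hb hy)

end Induction

theorem L₁_mul_one (μ : Weight) : L₁ * one μ = q ^ μ.1 • one μ := by
  simpa [one, gen, L₁] using RingQuot.mkAlgHom_rel Cq (Rel.L₁_idem μ)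

theorem L₂_mul_one (μ : Weight) : L₂ * one μ = q ^ μ.2 • one μ := by
  simpa [one, gen, L₂] using RingQuot.mkAlgHom_rel Cq (Rel.L₂_idem μ)

theorem L₁inv_mul_L₁ : gen Gen.L₁inv * L₁ = 1 := by
  simpa [gen, L₁] using RingQuot.mkAlgHom_rel Cq Rel.L₁_inv_mul

theorem L₂inv_mul_L₂ : gen Gen.L₂inv * L₂ = 1 := by
  simpa [gen, L₂] using RingQuot.mkAlgHom_rel Cq Rel.L₂_inv_mul

theorem L₁inv_mul_one (μ : Weight) : gen Gen.L₁inv * one μ = q ^ (-μ.1) • one μ := by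
  have h : gen Gen.L₁inv * (L₁ * one μ) = one μ := by
    rw [← mul_assoc, L₁inv_mul_L₁, one_mul]
  rw [L₁_mul_one, mul_smul_comm] at h
  rw [← h, smul_smul, ← zpow_add₀ q_ne_zero, neg_add_cancel, zpow_zero, one_smul, h]

theorem L₂inv_mul_one (μ : Weight) : gen Gen.L₂inv * one μ = q ^ (-μ.2) • one μ := by
  have h : gen Gen.L₂inv * (L₂ * one μ) = one μ := by
    rw [← mul_assoc, L₂inv_mul_L₂, one_mul]
  rw [L₂_mul_one, mul_smul_comm] at h
  rw [← h, smul_smul, ← zpow_add₀ q_ne_zero, neg_add_cancel, zpow_zero, one_smul, h]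

theorem E_mul_F_mul_one (μ : Weight) :
    E * F * one μ = F * E * one μ + qZ (μ.1 - μ.2) • one μ := by
  have h : E * F - F * E = (q - q⁻¹)⁻¹ • (L₁ * gen Gen.L₂inv - L₂ * gen Gen.L₁inv) := by
    simpa [gen, E, F, L₁, L₂] using RingQuot.mkAlgHom_rel Cq Rel.E_F
  rw [sub_eq_iff_eq_add'.1 h, add_mul, smul_mul_assoc, sub_mul, mul_assoc L₁, mul_assoc L₂,
    L₁inv_mul_one, L₂inv_mul_one, mul_smul_comm, mul_smul_comm, L₁_mul_one, L₂_mul_one,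
    smul_smul, smul_smul, ← sub_smul, smul_smul, ← zpow_add₀ q_ne_zero, ← zpow_add₀ q_ne_zero,
    qZ, div_eq_inv_mul]
  congr 5
  · ring
  · ring

/-- Moving the idempotent past the rightmost `F` allows the induction hypothesis to be used at
weight `μ - α`; the two scalars then combine by `qZ_add_mul`. -/
theorem E_mul_F_pow_succ_mul_one (a : ℕ) (μ : Weight) :
    E * F ^ (a + 1) * one μ = F ^ (a + 1) * E * one μ
      + (qZ (a + 1) * qZ (μ.1 - μ.2 - a)) • (F ^ a * one μ) := by
  induction a generalizing μ with
  | zero => simp [E_mul_F_mul_one, qZ_one]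
  | succ a ih =>
    have h1 : E * F ^ (a + 1 + 1) * one μ = E * F ^ (a + 1) * one (μ - α) * F := by
      rw [pow_succ _ (a + 1), ← mul_assoc, mul_assoc _ F, F_mul_one, ← mul_assoc]
    have h2 : F ^ (a + 1) * E * one (μ - α) * F = F ^ (a + 1) * (E * F * one μ) := by
      rw [mul_assoc _ (one _), ← F_mul_one]
      simp only [mul_assoc]
    have h3 : F ^ a * one (μ - α) * F = F ^ (a + 1) * one μ := by
      rw [mul_assoc _ (one _), ← F_mul_one, ← mul_assoc, pow_succ]
    rw [h1, ih, add_mul, h2, smul_mul_assoc, h3, E_mul_F_mul_one, mul_add, mul_smul_comm,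
      add_assoc, ← add_smul]
    congr 1
    · rw [pow_succ _ (a + 1)]; simp only [mul_assoc]
    · congr 1
      have := qZ_add_mul (μ.1 - μ.2) (a + 1)
      push_cast
      rw [← this]
      simp only [α, Prod.fst_sub, Prod.snd_sub]
      congr 3
      ring

theorem F_mul_E_pow_succ_mul_one (a : ℕ) (μ : Weight) :
    F * E ^ (a + 1) * one μ = E ^ (a + 1) * F * one μ
      + (qZ (a + 1) * qZ (μ.2 - μ.1 - a)) • (E ^ a * one μ) := by
  have h0 : ∀ μ : Weight, F * E * one μ = E * F * one μ + qZ (μ.2 - μ.1) • one μ := by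
    intro μ
    rw [E_mul_F_mul_one, ← neg_sub μ.1, qZ_neg, add_assoc, ← add_smul, add_neg_cancel, zero_smul,
      add_zero]
  induction a generalizing μ with
  | zero => simp [h0, qZ_one]
  | succ a ih =>
    have h1 : F * E ^ (a + 1 + 1) * one μ = F * E ^ (a + 1) * one (μ + α) * E := by
      rw [pow_succ _ (a + 1), ← mul_assoc, mul_assoc _ E, E_mul_one, ← mul_assoc]
    have h2 : E ^ (a + 1) * F * one (μ + α) * E = E ^ (a + 1) * (F * E * one μ) := by
      rw [mul_assoc _ (one _), ← E_mul_one]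
      simp only [mul_assoc]
    have h3 : E ^ a * one (μ + α) * E = E ^ (a + 1) * one μ := by
      rw [mul_assoc _ (one _), ← E_mul_one, ← mul_assoc, pow_succ]
    rw [h1, ih, add_mul, h2, smul_mul_assoc, h3, h0, mul_add, mul_smul_comm,
      add_assoc, ← add_smul]
    congr 1
    · rw [pow_succ _ (a + 1)]; simp only [mul_assoc]
    · congr 1
      have := qZ_add_mul (μ.2 - μ.1) (a + 1)
      push_cast
      rw [← this]
      simp only [α, Prod.fst_add, Prod.snd_add]
      congr 3
      ring

theorem F_pow_mul_E_pow_mul_one (a b : ℕ) (μ : Weight) :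
    F ^ a * E ^ b * one μ = one (μ + b • α - a • α) * (F ^ a * E ^ b) := by
  rw [mul_assoc, E_pow_mul_one, ← mul_assoc, F_pow_mul_one, mul_assoc]

theorem E_pow_mul_F_pow_mul_one (a b : ℕ) (μ : Weight) :
    E ^ a * F ^ b * one μ = one (μ - b • α + a • α) * (E ^ a * F ^ b) := by
  rw [mul_assoc, F_pow_mul_one, ← mul_assoc, E_pow_mul_one, mul_assoc]

section Weight

variable {X : Type*} [AddCommGroup X] [Module U' X]

theorem one_smul_of_weight {z : X} {lam : Weight} (hz : one lam • z = z) (μ : Weight) :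
    one μ • z = if μ = lam then z else 0 := by
  split_ifs with h
  · rw [h, hz]
  · rw [← hz, smul_smul, one_mul_one_of_ne h, zero_smul]

variable [Module Cq X] [IsScalarTower Cq U' X]

/-- Weight vectors are eigenvectors for all generators other than `E` and `F`. -/
theorem gen_smul_mem_of_weight (N : Submodule Cq X) {z : X} {lam : Weight}
    (hz : one lam • z = z) (hN : z ∈ N) (hE : E • z ∈ N) (hF : F • z ∈ N) (x : Gen) :
    gen x • z ∈ N := by
  have hL : ∀ (u : U') (c : Cq), u * one lam = c • one lam → u • z ∈ N := by
    intro u c h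
    rw [← hz, smul_smul, h, smul_assoc, hz]
    exact N.smul_mem _ hN
  cases x with
  | E => exact hE
  | F => exact hF
  | L₁ => exact hL _ _ (L₁_mul_one lam)
  | L₂ => exact hL _ _ (L₂_mul_one lam)
  | L₁inv => exact hL _ _ (L₁inv_mul_one lam)
  | L₂inv => exact hL _ _ (L₂inv_mul_one lam)
  | idem μ =>
    have h := one_smul_of_weight hz μ
    split_ifs at h
    · exact h.symm ▸ hN
    · exact h.symm ▸ N.zero_mem

end Weight

/-- `U' 1_ν` is spanned by the elements `F ^ a * E ^ b * 1_ν`. -/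
theorem mul_one_mem_span_FE (x : U') (ν : Weight) :
    x * one ν ∈ Submodule.span Cq (Set.range fun p : ℕ × ℕ => F ^ p.1 * E ^ p.2 * one ν) := by
  set N := Submodule.span Cq (Set.range fun p : ℕ × ℕ => F ^ p.1 * E ^ p.2 * one ν)
  have hN : ∀ a b, F ^ a * E ^ b * one ν ∈ N := fun a b => Submodule.subset_span ⟨(a, b), rfl⟩
  refine smul_mem_of_gen N ?_ x (y := one ν) (by simpa using hN 0 0)
  intro g y hy
  induction hy using Submodule.span_induction with
  | zero => rw [smul_zero]; exact N.zero_mem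
  | add y z _ _ hy hz => rw [smul_add]; exact N.add_mem hy hz
  | smul c y _ hy => rw [smul_comm]; exact N.smul_mem _ hy
  | mem y hy =>
    obtain ⟨⟨a, b⟩, rfl⟩ := hy
    refine gen_smul_mem_of_weight N (lam := ν + b • α - a • α) ?_ (hN a b) ?_ ?_ g
    · rw [smul_eq_mul, F_pow_mul_E_pow_mul_one, ← mul_assoc, one_mul_one_self]
    · cases a with
      | zero => simpa [pow_succ', mul_assoc] using hN 0 (b + 1)
      | succ a =>
        have h : E * (F ^ (a + 1) * E ^ b * one ν)
            = E * F ^ (a + 1) * one (ν + b • α) * E ^ b := by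
          rw [mul_assoc _ _ (one ν), E_pow_mul_one]
          simp only [mul_assoc]
        -- Commuting `E` to the right leaves `F^(a+1) E^(b+1)` and a multiple of `F^a E^b`, both in
        -- the span.
        rw [smul_eq_mul, h, E_mul_F_pow_succ_mul_one, add_mul, smul_mul_assoc, mul_assoc _ (one _),
          mul_assoc _ (one _), ← E_pow_mul_one]
        refine N.add_mem ?_ (N.smul_mem _ ?_)
        · simpa [pow_succ', mul_assoc] using hN (a + 1) (b + 1)
        · simpa [mul_assoc] using hN a b
    · simpa [pow_succ', mul_assoc] using hN (a + 1) b

/-- `U' 1_ν` is spanned by the elements `E ^ a * F ^ b * 1_ν`. -/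
theorem mul_one_mem_span_EF (x : U') (ν : Weight) :
    x * one ν ∈ Submodule.span Cq (Set.range fun p : ℕ × ℕ => E ^ p.1 * F ^ p.2 * one ν) := by
  set N := Submodule.span Cq (Set.range fun p : ℕ × ℕ => E ^ p.1 * F ^ p.2 * one ν)
  have hN : ∀ a b, E ^ a * F ^ b * one ν ∈ N := fun a b => Submodule.subset_span ⟨(a, b), rfl⟩
  refine smul_mem_of_gen N ?_ x (y := one ν) (by simpa using hN 0 0)
  intro g y hy
  induction hy using Submodule.span_induction with
  | zero => rw [smul_zero]; exact N.zero_mem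
  | add y z _ _ hy hz => rw [smul_add]; exact N.add_mem hy hz
  | smul c y _ hy => rw [smul_comm]; exact N.smul_mem _ hy
  | mem y hy =>
    obtain ⟨⟨a, b⟩, rfl⟩ := hy
    refine gen_smul_mem_of_weight N (lam := ν - b • α + a • α) ?_ (hN a b) ?_ ?_ g
    · rw [smul_eq_mul, E_pow_mul_F_pow_mul_one, ← mul_assoc, one_mul_one_self]
    · simpa [pow_succ', mul_assoc] using hN (a + 1) b
    · cases a with
      | zero => simpa [pow_succ', mul_assoc] using hN 0 (b + 1)
      | succ a =>
        have h : F * (E ^ (a + 1) * F ^ b * one ν)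
            = F * E ^ (a + 1) * one (ν - b • α) * F ^ b := by
          rw [mul_assoc _ _ (one ν), F_pow_mul_one]
          simp only [mul_assoc]
        rw [smul_eq_mul, h, F_mul_E_pow_succ_mul_one, add_mul, smul_mul_assoc, mul_assoc _ (one _),
          mul_assoc _ (one _), ← F_pow_mul_one]
        refine N.add_mem ?_ (N.smul_mem _ ?_)
        · simpa [pow_succ', mul_assoc] using hN (a + 1) (b + 1)
        · simpa [mul_assoc] using hN a b

theorem F_pow_mul_E_pow_mul_one_mem (a b : ℕ) (ν : Weight) :
    F ^ a * E ^ b * one ν ∈ Udot := by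
  have h := one_mul_mul_one_mem (ν + b • α - a • α) ν (F ^ a * E ^ b)
  rwa [← F_pow_mul_E_pow_mul_one, mul_assoc, one_mul_one_self] at h

/-- No idempotent is needed on the left: the spanning elements `F^a E^b 1_ν` already have a definite
left weight. -/
theorem mul_one_mem (x : U') (ν : Weight) : x * one ν ∈ Udot := by
  have h := mul_one_mem_span_FE x ν
  have hle : Submodule.span Cq (Set.range fun p : ℕ × ℕ => F ^ p.1 * E ^ p.2 * one ν)
      ≤ Udot.toSubmodule := by
    rw [Submodule.span_le]
    rintro _ ⟨p, rfl⟩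
    exact F_pow_mul_E_pow_mul_one_mem p.1 p.2 ν
  exact hle h

/-! ### The dual Verma module. -/

/-- The action of the generators on the dual Verma module of highest weight `ν`. -/
def vermaGen (ν : Weight) : Gen → Module.End Cq (ℕ →₀ Cq)
  -- The truncated index at `i = 0` is harmless because `qZ 0 = 0`.
  | .E => Finsupp.linearCombination Cq fun i => qZ i • Finsupp.single (i - 1) (1 : Cq)
  | .F => Finsupp.linearCombination Cq fun i =>
      qZ (ν.1 - ν.2 - i) • Finsupp.single (i + 1) (1 : Cq)
  | .L₁ => Finsupp.linearCombination Cq fun i => q ^ (ν.1 - i) • Finsupp.single i (1 : Cq)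
  | .L₂ => Finsupp.linearCombination Cq fun i => q ^ (ν.2 + i) • Finsupp.single i (1 : Cq)
  | .L₁inv => Finsupp.linearCombination Cq fun i => q ^ (-(ν.1 - i)) • Finsupp.single i (1 : Cq)
  | .L₂inv => Finsupp.linearCombination Cq fun i => q ^ (-(ν.2 + i)) • Finsupp.single i (1 : Cq)
  | .idem μ => Finsupp.linearCombination Cq fun i : ℕ =>
      if μ = ν - i • α then Finsupp.single i (1 : Cq) else 0

theorem end_finsupp_ext {f g : Module.End Cq (ℕ →₀ Cq)}
    (h : ∀ i, f (Finsupp.single i 1) = g (Finsupp.single i 1)) : f = g :=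
  Finsupp.basisSingleOne.ext fun i => by simpa using h i

theorem linearCombination_single_one (f : ℕ → ℕ →₀ Cq) (i : ℕ) :
    Finsupp.linearCombination Cq f (Finsupp.single i 1) = f i := by simp

theorem vermaGen_rel (ν : Weight) {a b : FreeAlgebra Cq Gen} (h : Rel a b) :
    FreeAlgebra.lift Cq (vermaGen ν) a = FreeAlgebra.lift Cq (vermaGen ν) b := by
  have hq := q_ne_zero
  have hz : ∀ a b : ℤ, q ^ a * q ^ b = q ^ (a + b) := fun a b => (zpow_add₀ hq a b).symm
  induction h <;> refine end_finsupp_ext fun i => ?_ <;>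
    simp only [map_mul, map_one, map_sub, map_smul, map_zero, FreeAlgebra.lift_ι_apply,
      Module.End.mul_apply, Module.End.one_apply, LinearMap.sub_apply, LinearMap.smul_apply,
      LinearMap.zero_apply, vermaGen, linearCombination_single_one, smul_smul, hz]
  case L₁_mul_inv => simp
  case L₁_inv_mul => simp
  case L₂_mul_inv => simp
  case L₂_inv_mul => simp
  case L_comm => rw [add_comm]
  case L₁_E =>
    cases i with
    | zero => simp [qZ_zero]
    | succ i =>
      rw [Nat.add_sub_cancel, show ν.1 - (i : ℤ) = 1 + (ν.1 - ((i + 1 : ℕ) : ℤ)) by push_cast; ring,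
        ← hz, zpow_one]
      ring_nf
  case L₂_E =>
    cases i with
    | zero => simp [qZ_zero]
    | succ i =>
      rw [Nat.add_sub_cancel,
        show ν.2 + (i : ℤ) = -1 + (ν.2 + ((i + 1 : ℕ) : ℤ)) by push_cast; ring, ← hz, zpow_neg_one]
      ring_nf
  case L₁_F =>
    rw [show ν.1 - ((i + 1 : ℕ) : ℤ) = -1 + (ν.1 - (i : ℤ)) by push_cast; ring, ← hz, zpow_neg_one]
    ring_nf
  case L₂_F =>
    rw [show ν.2 + ((i + 1 : ℕ) : ℤ) = 1 + (ν.2 + (i : ℤ)) by push_cast; ring, ← hz, zpow_one]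
    ring_nf
  -- On the `i`-th basis vector, with `h = ν₁ - ν₂`, the relation reads `[h-i][i+1] - [i][h-i+1] =
  -- [h-2i]`.
  case E_F =>
    have h := qZ_mul_sub_mul (ν.1 - ν.2) i
    rw [← sub_smul, smul_smul]
    have h1 : (q - q⁻¹)⁻¹ * (q ^ (-(ν.2 + (i : ℤ)) + (ν.1 - i)) - q ^ (-(ν.1 - (i : ℤ)) + (ν.2 + i)))
        = qZ (ν.1 - ν.2 - 2 * i) := by
      rw [qZ, div_eq_inv_mul]
      congr 3 <;> ring
    rw [h1, ← h, sub_smul]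
    cases i with
    | zero => simp [qZ_zero]
    | succ i =>
      rw [Nat.add_sub_cancel, Nat.add_sub_cancel,
        show ν.1 - ν.2 - (i : ℤ) = ν.1 - ν.2 - ((i + 1 : ℕ) : ℤ) + 1 by push_cast; ring]
      push_cast
      rfl
  case idem_mul_self μ => split_ifs <;> simp_all
  case idem_mul_of_ne μ μ' h => split_ifs <;> simp_all
  case E_idem μ =>
    cases i with
    | zero => split_ifs <;> simp [qZ_zero]
    | succ i =>
      have h : μ = ν - (i + 1) • α ↔ μ + α = ν - i • α := by
        rw [succ_nsmul, ← sub_sub, eq_sub_iff_add_eq]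
      rw [Nat.add_sub_cancel]
      by_cases hμ : μ = ν - (i + 1) • α
      · rw [if_pos hμ, if_pos (h.1 hμ), linearCombination_single_one, Nat.add_sub_cancel]
      · rw [if_neg hμ, if_neg (mt h.2 hμ), map_zero, smul_zero]
  case F_idem μ =>
    have h : μ = ν - i • α ↔ μ - α = ν - (i + 1) • α := by
      rw [succ_nsmul, ← sub_sub, sub_left_inj]
    by_cases hμ : μ = ν - i • α
    · rw [if_pos hμ, if_pos (h.1 hμ), linearCombination_single_one]
    · rw [if_neg hμ, if_neg (mt h.2 hμ), map_zero, smul_zero]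
  case L₁_idem μ => split_ifs with h <;> simp [h, α]
  case L₂_idem μ => split_ifs with h <;> simp [h, α]

/-- The action of `U'` on the dual Verma module of highest weight `ν`. -/
def verma (ν : Weight) : U' →ₐ[Cq] Module.End Cq (ℕ →₀ Cq) :=
  RingQuot.liftAlgHom Cq ⟨FreeAlgebra.lift Cq (vermaGen ν), fun _ _ => vermaGen_rel ν⟩

theorem verma_gen (ν : Weight) (x : Gen) : verma ν (gen x) = vermaGen ν x := by
  simp [verma, gen]

theorem verma_F_pow (ν : Weight) (i : ℕ) : verma ν (F ^ i) (Finsupp.single 0 1)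
    = (∏ s ∈ Finset.range i, qZ (ν.1 - ν.2 - s)) • Finsupp.single i 1 := by
  induction i with
  | zero => simp
  | succ i ih =>
    rw [pow_succ', map_mul, Module.End.mul_apply, ih, map_smul, F, verma_gen, vermaGen,
      linearCombination_single_one, smul_smul, Finset.prod_range_succ]

/-- The `(ν₁ - ν₂ + 1)`-st power of `F` acts on the top vector through a product containing the
factor `[0]`. As 1 does not kill this vector, 1 is not in `hwRelations ν`. -/
theorem verma_hwRelations {ν : Weight} (hν : ν.2 ≤ ν.1) {x : U'} (hx : x ∈ hwRelations ν) :
    verma ν x (Finsupp.single 0 1) = 0 := by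
  induction hx using Submodule.span_induction with
  | zero => simp
  | add x y _ _ hx hy => rw [map_add, LinearMap.add_apply, hx, hy, add_zero]
  | smul u x _ hx => rw [smul_eq_mul, map_mul, Module.End.mul_apply, hx, map_zero]
  | mem x hx =>
    simp only [Set.mem_insert_iff, Set.mem_singleton_iff] at hx
    rcases hx with rfl | rfl | rfl | rfl | rfl
    · simp [L₁, verma_gen, vermaGen, Module.algebraMap_end_apply]
    · simp [L₂, verma_gen, vermaGen, Module.algebraMap_end_apply]
    · simp [E, verma_gen, vermaGen, qZ_zero]
    · rw [Fdiv, map_smul, LinearMap.smul_apply, verma_F_pow, Finset.prod_eq_zero (i :=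
        (ν.1 - ν.2).toNat), zero_smul, smul_zero]
      · rw [Finset.mem_range]; omega
      · rw [Int.toNat_of_nonneg (by omega), sub_self, qZ_zero]
    · simp [one, verma_gen, vermaGen]

/-! ### Structure of highest weight modules. -/

/-- `v` is a non-zero generator of the `U'`-module `X` that satisfies the relations of a highest
weight vector of weight `ν`. -/
structure IsHwVec {X : Type*} [AddCommGroup X] [Module U' X] (ν : Weight) (v : X) : Prop where
  dominant : ν.2 ≤ ν.1
  ne_zero : v ≠ 0
  one_smul : one ν • v = v
  E_smul : E • v = 0
  F_smul : Fdiv (ν.1 - ν.2 + 1).toNat • v = 0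
  generates : ∀ x : X, ∃ u : U', u • v = x

/-- The relations for `L_i` need not be recorded, since they follow from `L_i 1_ν = q ^ ν_i 1_ν`. -/
theorem isHwVec_mk {ν : Weight} (hν : ν.2 ≤ ν.1) :
    IsHwVec ν (Submodule.Quotient.mk 1 : V ν) := by
  have h1 : ∀ u : U', u • (Submodule.Quotient.mk 1 : V ν) = Submodule.Quotient.mk u := by
    intro u
    rw [← Submodule.Quotient.mk_smul, smul_eq_mul, mul_one]
  have h2 : ∀ u ∈ hwRelations ν, u • (Submodule.Quotient.mk 1 : V ν) = 0 := by
    intro u hu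
    rwa [h1, Submodule.Quotient.mk_eq_zero]
  refine ⟨hν, ?_, ?_, ?_, ?_, ?_⟩
  · rw [Ne, Submodule.Quotient.mk_eq_zero]
    intro h
    have := verma_hwRelations hν h
    simp at this
  · have h : (one ν - 1) • (Submodule.Quotient.mk 1 : V ν) = 0 :=
      h2 _ (Submodule.subset_span (by simp))
    rwa [sub_smul, one_smul, sub_eq_zero] at h
  · exact h2 _ (Submodule.subset_span (by simp))
  · exact h2 _ (Submodule.subset_span (by simp))
  · intro x
    obtain ⟨u, rfl⟩ := Submodule.Quotient.mk_surjective _ x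
    exact ⟨u, h1 u⟩

section HighestWeight

variable {X : Type*} [AddCommGroup X] [Module U' X] {ν : Weight} {v : X}

namespace IsHwVec

theorem one_smul_Fdiv_smul_self (hv : IsHwVec ν v) (i : ℕ) :
    one (ν - i • α) • Fdiv i • v = Fdiv i • v := by
  rw [smul_smul, Fdiv, mul_smul_comm, ← F_pow_mul_one, ← smul_mul_assoc, mul_smul, hv.one_smul]

theorem one_smul_Fdiv_smul (hv : IsHwVec ν v) (μ : Weight) (i : ℕ) :
    one μ • Fdiv i • v = if μ = ν - i • α then Fdiv i • v else 0 :=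
  one_smul_of_weight (hv.one_smul_Fdiv_smul_self i) μ

end IsHwVec

variable [Module Cq X] [IsScalarTower Cq U' X]

theorem F_smul_Fdiv_smul (v : X) (i : ℕ) :
    F • Fdiv i • v = qInt (i + 1) • Fdiv (i + 1) • v := by
  rw [smul_smul, Fdiv, Fdiv, mul_smul_comm, ← pow_succ', ← smul_assoc, smul_smul,
    qFactorial_succ, mul_inv, mul_comm (qFactorial i)⁻¹, ← mul_assoc,
    mul_inv_cancel₀ (qInt_ne_zero (Nat.succ_ne_zero i)), one_mul]

theorem Fdiv_smul_Fdiv_smul (v : X) (a i : ℕ) :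
    Fdiv a • Fdiv i • v = qBinom (a + i) a • Fdiv (a + i) • v := by
  rw [smul_smul, Fdiv, Fdiv, Fdiv, smul_mul_smul_comm, ← pow_add, ← smul_assoc, smul_smul]
  congr 2
  rw [qBinom, Nat.add_sub_cancel_left]
  have h1 := qFactorial_ne_zero a
  have h2 := qFactorial_ne_zero i
  have h3 := qFactorial_ne_zero (a + i)
  field_simp

namespace IsHwVec

theorem Fdiv_smul_eq_zero (hv : IsHwVec ν v) {i : ℕ} (hi : (ν.1 - ν.2).toNat < i) :
    Fdiv i • v = 0 := by
  have hν := hv.dominant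
  induction i, hi using Nat.le_induction with
  | base =>
    rw [show (ν.1 - ν.2).toNat.succ = (ν.1 - ν.2 + 1).toNat by omega]
    exact hv.F_smul
  | succ i _ ih =>
    have h := F_smul_Fdiv_smul v i
    rw [ih, smul_zero] at h
    exact (smul_eq_zero.1 h.symm).resolve_left (qInt_ne_zero (Nat.succ_ne_zero i))

theorem E_smul_Fdiv_zero_smul (hv : IsHwVec ν v) : E • Fdiv 0 • v = 0 := by
  rw [Fdiv, pow_zero, smul_assoc, _root_.one_smul, smul_comm, hv.E_smul, smul_zero]

theorem E_smul_Fdiv_succ_smul (hv : IsHwVec ν v) (i : ℕ) :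
    E • Fdiv (i + 1) • v = qZ (ν.1 - ν.2 - i) • Fdiv i • v := by
  have h : (E * F ^ (i + 1)) • v = (qZ (i + 1) * qZ (ν.1 - ν.2 - i)) • (F ^ i • v) := by
    nth_rewrite 1 [← hv.one_smul]
    rw [smul_smul, E_mul_F_pow_succ_mul_one, add_smul, mul_smul,
      hv.one_smul, mul_smul, hv.E_smul, smul_zero, zero_add, smul_assoc, mul_smul (F ^ i),
      hv.one_smul]
  rw [smul_smul, Fdiv, Fdiv, mul_smul_comm, smul_assoc, h, smul_assoc, smul_smul,
    smul_smul]
  congr 1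
  rw [qFactorial_succ, qInt_eq_qZ]
  have h1 := qFactorial_ne_zero i
  have h2 : qZ ((i : ℤ) + 1) ≠ 0 := by exact_mod_cast qInt_ne_zero (Nat.succ_ne_zero i)
  push_cast
  field_simp

theorem E_pow_smul_Fdiv_smul (hv : IsHwVec ν v) (a i : ℕ) (h : a + i ≤ (ν.1 - ν.2).toNat) :
    E ^ a • Fdiv (a + i) • v = (qFactorial ((ν.1 - ν.2).toNat - i) /
      qFactorial ((ν.1 - ν.2).toNat - i - a)) • Fdiv i • v := by
  induction a with
  | zero => simp [div_self (qFactorial_ne_zero _)]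
  | succ a ih =>
    rw [pow_succ, mul_smul, show a + 1 + i = a + i + 1 by ring, hv.E_smul_Fdiv_succ_smul,
      smul_comm, ih (by omega), smul_smul]
    congr 1
    obtain ⟨e, he⟩ : ∃ e, (ν.1 - ν.2).toNat - i - a = e + 1 :=
      ⟨(ν.1 - ν.2).toNat - i - a - 1, by omega⟩
    rw [← Nat.sub_sub, he, Nat.add_sub_cancel, qFactorial_succ,
      show ν.1 - ν.2 - ((a + i : ℕ) : ℤ) = ((e + 1 : ℕ) : ℤ) by omega, ← qInt_eq_qZ]
    have h1 := qFactorial_ne_zero e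
    have h2 := qInt_ne_zero (Nat.succ_ne_zero e)
    field_simp

theorem Ediv_smul_Fdiv_smul (hv : IsHwVec ν v) (a i : ℕ) (h : a + i ≤ (ν.1 - ν.2).toNat) :
    Ediv a • Fdiv (a + i) • v = qBinom ((ν.1 - ν.2).toNat - i) a • Fdiv i • v := by
  rw [Ediv, smul_assoc, hv.E_pow_smul_Fdiv_smul a i h, smul_smul]
  congr 1
  rw [qBinom]
  have h1 := qFactorial_ne_zero a
  field_simp

theorem Ediv_smul_Fdiv_smul_of_lt (hv : IsHwVec ν v) {a i : ℕ} (h : i < a) :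
    Ediv a • Fdiv i • v = 0 := by
  have key : ∀ i a, i < a → E ^ a • Fdiv i • v = 0 := by
    intro i
    induction i with
    | zero =>
      intro a ha
      obtain ⟨b, rfl⟩ := Nat.exists_eq_succ_of_ne_zero ha.ne'
      rw [pow_succ, mul_smul, hv.E_smul_Fdiv_zero_smul, smul_zero]
    | succ i ih =>
      intro a ha
      obtain ⟨b, rfl⟩ := Nat.exists_eq_succ_of_ne_zero (Nat.ne_zero_of_lt ha)
      rw [pow_succ, mul_smul, hv.E_smul_Fdiv_succ_smul, smul_comm, ih b (by omega), smul_zero]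
  rw [Ediv, smul_assoc, key i a h, smul_zero]

/-- Applying `E^(i)` returns a non-zero binomial multiple of `v`. -/
theorem Fdiv_smul_ne_zero (hv : IsHwVec ν v) {i : ℕ} (hi : i ≤ (ν.1 - ν.2).toNat) :
    Fdiv i • v ≠ 0 := by
  intro h
  have h1 := hv.Ediv_smul_Fdiv_smul i 0 hi
  rw [add_zero, h, smul_zero] at h1
  have h2 := (smul_eq_zero.1 h1.symm).resolve_left (qBinom_ne_zero _ _)
  rw [Fdiv, pow_zero, qFactorial_zero, inv_one, _root_.one_smul, _root_.one_smul] at h2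
  exact hv.ne_zero h2

theorem span_Fdiv_smul (hv : IsHwVec ν v) :
    Submodule.span Cq (Set.range fun i : Fin ((ν.1 - ν.2).toNat + 1) => Fdiv i • v) = ⊤ := by
  set N := Submodule.span Cq (Set.range fun i : Fin ((ν.1 - ν.2).toNat + 1) => Fdiv i • v)
  have hN : ∀ i : ℕ, Fdiv i • v ∈ N := by
    intro i
    by_cases hi : i < (ν.1 - ν.2).toNat + 1
    · exact Submodule.subset_span ⟨⟨i, hi⟩, rfl⟩
    · rw [hv.Fdiv_smul_eq_zero (by omega)]
      exact N.zero_mem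
  have hvN : v ∈ N := by simpa [Fdiv, qFactorial_zero] using hN 0
  refine eq_top_iff.2 fun x _ => ?_
  obtain ⟨u, rfl⟩ := hv.generates x
  refine smul_mem_of_gen N ?_ u hvN
  intro g y hy
  induction hy using Submodule.span_induction with
  | zero => rw [smul_zero]; exact N.zero_mem
  | add y z _ _ hy hz => rw [smul_add]; exact N.add_mem hy hz
  | smul c y _ hy => rw [smul_comm]; exact N.smul_mem _ hy
  | mem y hy =>
    obtain ⟨⟨i, hi⟩, rfl⟩ := hy
    refine gen_smul_mem_of_weight N (hv.one_smul_Fdiv_smul_self i) (hN i) ?_ ?_ g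
    · cases i with
      | zero => exact hv.E_smul_Fdiv_zero_smul.symm ▸ N.zero_mem
      | succ i => exact (hv.E_smul_Fdiv_succ_smul i).symm ▸ N.smul_mem _ (hN i)
    · exact (F_smul_Fdiv_smul v i).symm ▸ N.smul_mem _ (hN (i + 1))

theorem weight_injective (ν : Weight) {i j : ℕ} (h : ν - i • α = ν - j • α) : i = j := by
  have := congrArg Prod.fst h
  simpa [α] using this

/-- The vectors are non-zero of distinct weights, so the idempotents isolate each coefficient. -/
theorem linearIndependent_Fdiv_smul (hv : IsHwVec ν v) :
    LinearIndependent Cq fun i : Fin ((ν.1 - ν.2).toNat + 1) => Fdiv i • v := by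
  rw [Fintype.linearIndependent_iff]
  intro c hc i
  have h1 := congrArg (one (ν - (i : ℕ) • α) • ·) hc
  simp only [Finset.smul_sum, smul_zero] at h1
  rw [Finset.sum_eq_single i, smul_comm, hv.one_smul_Fdiv_smul_self] at h1
  · exact (smul_eq_zero.1 h1).resolve_right (hv.Fdiv_smul_ne_zero (by omega))
  · intro j _ hj
    rw [smul_comm, hv.one_smul_Fdiv_smul,
      if_neg fun h => hj (Fin.ext (weight_injective ν h).symm), smul_zero]
  · simp

/-- The basis of a highest weight module that consists of the vectors `F^(i) v`. -/
def basis (hv : IsHwVec ν v) : Module.Basis (Fin ((ν.1 - ν.2).toNat + 1)) Cq X :=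
  .mk hv.linearIndependent_Fdiv_smul hv.span_Fdiv_smul.ge

theorem basis_apply (hv : IsHwVec ν v) (i : Fin ((ν.1 - ν.2).toNat + 1)) :
    hv.basis i = Fdiv i • v := by simp [basis]

end IsHwVec

end HighestWeight

/-! ### Weights dominated by `(K, 0)` and the action of `projElt`. -/

theorem mem_DomWeights_iff {K : ℤ} {ν : Weight} :
    ν ∈ DomWeights (K, 0) ↔ ν.2 ≤ ν.1 ∧ 0 ≤ ν.2 ∧ ν.1 + ν.2 = K := by
  refine and_congr_right fun _ => ⟨?_, ?_⟩
  · rintro ⟨n, hn⟩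
    have h1 := congrArg Prod.fst hn
    have h2 := congrArg Prod.snd hn
    simp [α] at h1 h2
    omega
  · rintro ⟨h1, h2⟩
    refine ⟨ν.2.toNat, Prod.ext ?_ ?_⟩ <;> simp [α] <;> omega

theorem max_min_mem_DomWeights_iff {K : ℤ} {μ : Weight} :
    (max μ.1 μ.2, min μ.1 μ.2) ∈ DomWeights (K, 0) ↔ 0 ≤ μ.1 ∧ 0 ≤ μ.2 ∧ μ.1 + μ.2 = K := by
  rw [mem_DomWeights_iff]
  dsimp only
  omega

section HighestWeight

variable {X : Type*} [AddCommGroup X] [Module U' X] {ν : Weight} {v : X}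

theorem projElt_smul_eq_sum [Module Cq X] [IsScalarTower Cq U' X] (k l m : ℕ) (x : X) :
    projElt k l m • x = ∑ t ∈ Finset.range (m + 1),
      ((-1) ^ t * (qBinom (l - m + t) t / qBinom (k + l - 2 * m + t) (l - m + t))
        * (qInt (k + l - 2 * m + 1) / qInt (k + l - 2 * m + 1 + t))) •
      Fdiv (l - m + t) • Ediv (l - m + t) • one ((k : ℤ), (l : ℤ)) • x := by
  simp only [projElt, Finset.sum_smul, smul_assoc, mul_smul]

namespace IsHwVec

variable [Module Cq X] [IsScalarTower Cq U' X]

/-- The weights `ν - i • α` with `i ≤ ν₁ - ν₂` have non-negative coordinates with sum `K`. Hence the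
generators of the ideal act by zero. -/
theorem one_smul_eq_zero (hv : IsHwVec ν v) {K : ℤ} (hν : ν ∈ DomWeights (K, 0)) {μ : Weight}
    (hμ : (max μ.1 μ.2, min μ.1 μ.2) ∉ DomWeights (K, 0)) (x : X) : one μ • x = 0 := by
  rw [max_min_mem_DomWeights_iff] at hμ
  rw [mem_DomWeights_iff] at hν
  have h : ∀ i, one μ • hv.basis i = 0 := by
    intro i
    rw [hv.basis_apply, hv.one_smul_Fdiv_smul, if_neg]
    rintro rfl
    have := i.2
    simp [α] at hμ
    omega
  have h2 : Algebra.lsmul Cq Cq X (one μ) = 0 := hv.basis.ext fun i => by simpa using h i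
  exact LinearMap.congr_fun h2 x

/-- Here `A = l - m` and `B = k - m`. If `ν₂ > m`, then `i < A` and every `E^(A+t)` kills the
vector. Otherwise `d = m - ν₂` gives `i = A + d`, and the scalar is 1 for `d = 0` and the vanishing
sum for `d > 0`. -/
theorem projElt_smul_basis (hv : IsHwVec ν v) {A B m i : ℕ}
    (hν : ν.1 + ν.2 = (A + m : ℕ) + (B + m : ℕ)) (hν2 : 0 ≤ ν.2)
    (hi : i ≤ (ν.1 - ν.2).toNat) (hl : ((A + m : ℕ) : ℤ) = ν.2 + i) :
    projElt (B + m) (A + m) m • Fdiv i • v = if ν.2 = m then Fdiv i • v else 0 := by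
  have hdom := hv.dominant
  have hw : (((B + m : ℕ) : ℤ), ((A + m : ℕ) : ℤ)) = ν - i • α := by
    ext <;> simp [α] <;> omega
  rw [projElt_smul_eq_sum, hw, hv.one_smul_Fdiv_smul_self]
  by_cases hlt : ν.2 ≤ m
  · obtain ⟨j, hj⟩ := Int.eq_ofNat_of_zero_le hν2
    obtain ⟨d, rfl⟩ : ∃ d, m = j + d := ⟨m - j, by omega⟩
    obtain rfl : i = A + d := by omega
    have hn : (ν.1 - ν.2).toNat = A + B + 2 * d := by omega
    rw [show A + (j + d) - (j + d) = A by omega,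
      show B + (j + d) + (A + (j + d)) - 2 * (j + d) = A + B by omega]
    have key : ∀ t ∈ Finset.range (d + 1),
        ((-1) ^ t * (qBinom (A + t) t / qBinom (A + B + t) (A + t))
          * (qInt (A + B + 1) / qInt (A + B + 1 + t))) •
          Fdiv (A + t) • Ediv (A + t) • Fdiv (A + d) • v
        = (((-1) ^ t * (qBinom (A + t) t / qBinom (A + B + t) (A + t))
          * (qInt (A + B + 1) / qInt (A + B + 1 + t)))
          * (qBinom (B + d + (A + t)) (A + t) * qBinom (A + d) (A + t))) • Fdiv (A + d) • v := by
      intro t ht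
      have ht' := Finset.mem_range.1 ht
      have h1 := hv.Ediv_smul_Fdiv_smul (A + t) (d - t) (by omega)
      have h2 := Fdiv_smul_Fdiv_smul v (A + t) (d - t)
      rw [show A + t + (d - t) = A + d by omega] at h1 h2
      rw [h1, smul_comm (Fdiv (A + t)), h2, smul_smul, smul_smul, hn,
        show A + B + 2 * d - (d - t) = B + d + (A + t) by omega, ← mul_assoc]
    -- Terms with `t > d` vanish, because `E^(A+t)` then raises beyond the highest weight.
    rw [← Finset.sum_subset (s₁ := Finset.range (d + 1)), Finset.sum_congr rfl key,
      ← Finset.sum_smul]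
    · by_cases hd : d = 0
      · subst hd
        have h1 := projElt_scalar_eq_one A B
        rw [zero_add, Finset.sum_range_one]
        simp only [add_zero, pow_zero, one_mul] at h1 ⊢
        rw [h1, _root_.one_smul, if_pos hj]
      · rw [projElt_scalar_eq_zero A B d hd, zero_smul, if_neg (by omega)]
    · intro t ht
      rw [Finset.mem_range] at ht ⊢
      omega
    · intro t _ ht
      rw [Finset.mem_range] at ht
      rw [hv.Ediv_smul_Fdiv_smul_of_lt (by omega), smul_zero, smul_zero]
  · rw [if_neg (by omega)]
    refine Finset.sum_eq_zero fun t _ => ?_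
    rw [hv.Ediv_smul_Fdiv_smul_of_lt (by omega), smul_zero, smul_zero]

theorem projElt_smul (hv : IsHwVec ν v) {k l m : ℕ} (hk : m ≤ k) (hl : m ≤ l)
    (hν : ν ∈ DomWeights ((k : ℤ) + l, 0)) (x : X) :
    projElt k l m • x = if ν.2 = m then one ((k : ℤ), (l : ℤ)) • x else 0 := by
  have hdom := mem_DomWeights_iff.1 hν
  have h : ∀ i, projElt k l m • hv.basis i
      = if ν.2 = m then one ((k : ℤ), (l : ℤ)) • hv.basis i else 0 := by
    intro i
    have hi := i.2
    rw [hv.basis_apply]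
    by_cases hw : ((k : ℤ), (l : ℤ)) = ν - (i : ℕ) • α
    · obtain ⟨A, rfl⟩ : ∃ A, l = A + m := ⟨l - m, by omega⟩
      obtain ⟨B, rfl⟩ : ∃ B, k = B + m := ⟨k - m, by omega⟩
      have h2 := congrArg Prod.snd hw
      simp [α] at h2
      rw [hv.projElt_smul_basis (by omega) (by omega) (by omega) (by push_cast; omega), hw,
        hv.one_smul_Fdiv_smul_self]
    · rw [projElt_smul_eq_sum, hv.one_smul_Fdiv_smul, if_neg hw]
      simp
  have h2 : Algebra.lsmul Cq Cq X (projElt k l m)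
      = if ν.2 = m then Algebra.lsmul Cq Cq X (one ((k : ℤ), (l : ℤ))) else 0 := by
    refine hv.basis.ext fun i => ?_
    have := h i
    split_ifs at this ⊢ <;> simpa using this
  have h3 := LinearMap.congr_fun h2 x
  split_ifs at h3 ⊢ <;> simpa using h3

end IsHwVec

end HighestWeight

/-! ### A spanning set of `U̇` modulo the ideal. -/

/-- In a non-unital algebra a ring ideal need not be a subspace. Here it is, because the generators
are idempotent: `c • 1_μ = (c • 1_μ) * 1_μ`. -/
theorem smul_mem_idealI {lam : Weight} {x : Udot} (hx : x ∈ idealI lam) (c : Cq) :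
    c • x ∈ idealI lam := by
  let J : TwoSidedIdeal Udot := TwoSidedIdeal.mk' {y | c • y ∈ idealI lam}
    (by simp)
    (fun {y z} hy hz => by
      simpa only [Set.mem_ofPred_eq, smul_add] using (idealI lam).add_mem hy hz)
    (fun {y} hy => by
      simpa only [Set.mem_ofPred_eq, smul_neg] using (idealI lam).neg_mem hy)
    (fun {y z} hz => by
      simpa only [Set.mem_ofPred_eq, mul_smul_comm] using (idealI lam).mul_mem_left y _ hz)
    (fun {y z} hy => by
      simpa only [Set.mem_ofPred_eq, smul_mul_assoc] using (idealI lam).mul_mem_right _ z hy)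
  have hJ : idealI lam ≤ J := by
    refine TwoSidedIdeal.span_le.2 ?_
    rintro _ ⟨μ, hμ, rfl⟩
    refine (TwoSidedIdeal.mem_mk' _ _ _ _ _ _ _).2 ?_
    have h : c • oneDot μ = (c • oneDot μ) * oneDot μ := by
      rw [smul_mul_assoc]
      congr 1
      exact Subtype.ext (one_mul_one_self μ).symm
    rw [Set.mem_ofPred_eq, h]
    exact (idealI lam).mul_mem_left _ _ (TwoSidedIdeal.subset_span ⟨μ, hμ, rfl⟩)
  have hx' : x ∈ J := TwoSidedIdeal.le_iff.1 hJ hx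
  exact (TwoSidedIdeal.mem_mk' {y | c • y ∈ idealI lam} _ _ _ _ _ x).1 hx'

/-- The ideal `I_lam` as a subspace of `U'`. -/
def idealSub (lam : Weight) : Submodule Cq U' where
  carrier := {x | ∃ h : x ∈ Udot, (⟨x, h⟩ : Udot) ∈ idealI lam}
  zero_mem' := ⟨Udot.zero_mem, (idealI lam).zero_mem⟩
  add_mem' := fun ⟨hx, hx'⟩ ⟨hy, hy'⟩ => ⟨Udot.add_mem hx hy, (idealI lam).add_mem hx' hy'⟩
  smul_mem' := fun c _ ⟨hx, hx'⟩ => ⟨Udot.smul_mem' c hx, smul_mem_idealI hx' c⟩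

/-- Replacing `1_μ` by its cube leaves a generator of the ideal in the middle and puts both outer
factors in `U̇`. -/
theorem mul_one_mul_one_mem_idealSub {lam μ : Weight}
    (hμ : (max μ.1 μ.2, min μ.1 μ.2) ∉ DomWeights lam) (x y : U') (ν : Weight) :
    x * one μ * y * one ν ∈ idealSub lam := by
  have h : x * one μ * y * one ν = x * one μ * (one μ * y * one ν) := by
    simp only [← mul_assoc]
    rw [mul_assoc x (one μ) (one μ), one_mul_one_self]
  rw [h]
  refine ⟨Udot.mul_mem (mul_one_mem _ _) (one_mul_mul_one_mem _ _ _), ?_⟩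
  have h2 : (⟨x * one μ * (one μ * y * one ν),
      Udot.mul_mem (mul_one_mem _ _) (one_mul_mul_one_mem _ _ _)⟩ : Udot)
      = ⟨x * one μ, mul_one_mem _ _⟩ * oneDot μ * ⟨one μ * y * one ν, one_mul_mul_one_mem _ _ _⟩ := by
    refine Subtype.ext ?_
    change _ = x * one μ * one μ * (one μ * y * one ν)
    rw [mul_assoc x (one μ) (one μ), one_mul_one_self]
  rw [h2]
  exact (idealI lam).mul_mem_right _ _
    ((idealI lam).mul_mem_left _ _ (TwoSidedIdeal.subset_span ⟨μ, hμ, rfl⟩))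

/-- The index set of a basis of `⨁ End (V ν)`. -/
abbrev MatIndex (K : ℤ) : Type :=
  Σ ν : DomWeights (K, 0), Fin ((ν.1.1 - ν.1.2).toNat + 1) × Fin ((ν.1.1 - ν.1.2).toNat + 1)

/-- Elements of `U̇` that span `U̇` modulo the ideal `I_(K,0)`. -/
def spanElt (K : ℤ) (p : MatIndex K) : U' :=
  -- The first index gives the source weight, the second the target weight. The path between them
  -- runs through the highest weight of `V ν` in this case and through the lowest in the other. The
  -- inequality says that the second coordinates of source and target add up to at most `K`.
  if (p.2.1 : ℕ) + p.2.2 ≤ (p.1.1.1 - p.1.1.2).toNat then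
    F ^ (p.2.2 : ℕ) * E ^ (p.2.1 : ℕ) * one (p.1.1 - (p.2.1 : ℕ) • α)
  else
    E ^ ((p.1.1.1 - p.1.1.2).toNat - p.2.2) * F ^ ((p.1.1.1 - p.1.1.2).toNat - p.2.1)
      * one (p.1.1 - (p.2.1 : ℕ) • α)

/-- The product passes through `ν + b • α`. Either this weight has a negative coordinate, and the
product is in the ideal, or `h` forces it to be dominant, and the product is a `spanElt`. -/
theorem FE_mem_span_sup {K : ℤ} {μ ν : Weight} (a b : ℕ)
    (hν : 0 ≤ ν.1 ∧ 0 ≤ ν.2 ∧ ν.1 + ν.2 = K) (h : μ.2 + ν.2 ≤ K)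
    (hab : μ = ν + b • α - a • α) :
    F ^ a * E ^ b * one ν ∈ Submodule.span Cq (Set.range (spanElt K)) ⊔ idealSub (K, 0) := by
  have hab2 := congrArg Prod.snd hab
  simp only [α, Prod.smul_mk, Prod.snd_sub, Prod.snd_add, nsmul_eq_mul, mul_one] at hab2
  by_cases hb : ν.2 < b
  · refine Submodule.mem_sup_right ?_
    have h1 : F ^ a * E ^ b * one ν = F ^ a * one (ν + b • α) * E ^ b * one ν := by
      rw [mul_assoc (F ^ a) (one _), ← E_pow_mul_one, ← mul_assoc (F ^ a),
        mul_assoc _ (one ν) (one ν), one_mul_one_self]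
    rw [h1]
    refine mul_one_mul_one_mem_idealSub ?_ _ _ _
    rw [max_min_mem_DomWeights_iff]
    simp [α]
    omega
  · refine Submodule.mem_sup_left (Submodule.subset_span ?_)
    refine ⟨⟨⟨ν + b • α, ?_⟩, ⟨b, ?_⟩, ⟨a, ?_⟩⟩, ?_⟩
    · rw [mem_DomWeights_iff]
      simp [α]
      omega
    · simp [α]
      omega
    · simp [α]
      omega
    · rw [spanElt, if_pos]
      · simp
      · simp [α]
        omega

theorem EF_mem_span_sup {K : ℤ} {μ ν : Weight} (a b : ℕ)
    (hν : 0 ≤ ν.1 ∧ 0 ≤ ν.2 ∧ ν.1 + ν.2 = K) (h : K < μ.2 + ν.2)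
    (hab : μ = ν - b • α + a • α) :
    E ^ a * F ^ b * one ν ∈ Submodule.span Cq (Set.range (spanElt K)) ⊔ idealSub (K, 0) := by
  have hab2 := congrArg Prod.snd hab
  simp only [α, Prod.smul_mk, Prod.snd_sub, Prod.snd_add, nsmul_eq_mul, mul_one] at hab2
  by_cases hb : ν.1 < b
  · refine Submodule.mem_sup_right ?_
    have h1 : E ^ a * F ^ b * one ν = E ^ a * one (ν - b • α) * F ^ b * one ν := by
      rw [mul_assoc (E ^ a) (one _), ← F_pow_mul_one, ← mul_assoc (E ^ a),
        mul_assoc _ (one ν) (one ν), one_mul_one_self]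
    rw [h1]
    refine mul_one_mul_one_mem_idealSub ?_ _ _ _
    rw [max_min_mem_DomWeights_iff]
    simp [α]
    omega
  · refine Submodule.mem_sup_left (Submodule.subset_span ?_)
    -- The turning point `ν - b • α` is `(j, K - j)`, the lowest weight of `V_2(K - j, j)`, and `n =
    -- K - 2j` is the length of its weight string.
    obtain ⟨j, hj⟩ := Int.eq_ofNat_of_zero_le (a := ν.1 - b) (by omega)
    obtain ⟨n, hn⟩ := Int.eq_ofNat_of_zero_le (a := K - 2 * j) (by omega)
    refine ⟨⟨⟨(K - j, j), ?_⟩, ⟨n - b, ?_⟩, ⟨n - a, ?_⟩⟩, ?_⟩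
    · rw [mem_DomWeights_iff]
      dsimp only
      omega
    · dsimp only
      omega
    · dsimp only
      omega
    · have hn2 : (K - (j : ℤ) - j).toNat = n := by omega
      have hw : ((K - j, (j : ℤ)) : Weight) - (n - b) • α = ν := by
        ext <;> simp [α] <;> omega
      rw [spanElt, if_neg]
      · dsimp only
        rw [hn2, hw, show n - (n - a) = a by omega, show n - (n - b) = b by omega]
      · dsimp only
        omega

/-- The order of `E` and `F` is chosen by the sign of `μ₂ + ν₂ - K`, so that the turning point of
each product is an extremal weight. Using one order throughout would give too many elements for the
dimension count. -/
theorem one_mul_mul_one_mem_span_sup (K : ℤ) (μ ν : Weight) (x : U') :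
    one μ * x * one ν ∈ Submodule.span Cq (Set.range (spanElt K)) ⊔ idealSub (K, 0) := by
  by_cases hμ : (max μ.1 μ.2, min μ.1 μ.2) ∈ DomWeights (K, 0)
  swap
  · refine Submodule.mem_sup_right ?_
    simpa using mul_one_mul_one_mem_idealSub hμ 1 x ν
  by_cases hν : (max ν.1 ν.2, min ν.1 ν.2) ∈ DomWeights (K, 0)
  swap
  · refine Submodule.mem_sup_right ?_
    have := mul_one_mul_one_mem_idealSub hν (one μ * x) 1 ν
    rwa [mul_one, mul_assoc _ (one ν) (one ν), one_mul_one_self] at this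
  rw [max_min_mem_DomWeights_iff] at hμ hν
  rw [mul_assoc]
  by_cases h : μ.2 + ν.2 ≤ K
  · have hx := mul_one_mem_span_FE x ν
    generalize x * one ν = z at hx ⊢
    induction hx using Submodule.span_induction with
    | zero => rw [mul_zero]; exact Submodule.zero_mem _
    | add y z _ _ hy hz => rw [mul_add]; exact Submodule.add_mem _ hy hz
    | smul c y _ hy => rw [mul_smul_comm]; exact Submodule.smul_mem _ _ hy
    | mem y hy =>
      obtain ⟨⟨a, b⟩, rfl⟩ := hy
      dsimp only
      by_cases hab : μ = ν + b • α - a • α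
      · have h1 := FE_mem_span_sup a b hν h hab
        rwa [F_pow_mul_E_pow_mul_one, ← hab, ← mul_assoc, one_mul_one_self, hab,
          ← F_pow_mul_E_pow_mul_one]
      · rw [F_pow_mul_E_pow_mul_one, ← mul_assoc, one_mul_one_of_ne hab, zero_mul]
        exact Submodule.zero_mem _
  · have hx := mul_one_mem_span_EF x ν
    generalize x * one ν = z at hx ⊢
    induction hx using Submodule.span_induction with
    | zero => rw [mul_zero]; exact Submodule.zero_mem _
    | add y z _ _ hy hz => rw [mul_add]; exact Submodule.add_mem _ hy hz
    | smul c y _ hy => rw [mul_smul_comm]; exact Submodule.smul_mem _ _ hy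
    | mem y hy =>
      obtain ⟨⟨a, b⟩, rfl⟩ := hy
      dsimp only
      by_cases hab : μ = ν - b • α + a • α
      · have h1 := EF_mem_span_sup a b hν (not_le.1 h) hab
        rwa [E_pow_mul_F_pow_mul_one, ← hab, ← mul_assoc, one_mul_one_self, hab,
          ← E_pow_mul_F_pow_mul_one]
      · rw [E_pow_mul_F_pow_mul_one, ← mul_assoc, one_mul_one_of_ne hab, zero_mul]
        exact Submodule.zero_mem _

theorem Udot_le_span_sup (K : ℤ) :
    UdotSpan ≤ Submodule.span Cq (Set.range (spanElt K)) ⊔ idealSub (K, 0) := by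
  refine Submodule.span_le.2 ?_
  rintro _ ⟨μ, ν, x, rfl⟩
  exact one_mul_mul_one_mem_span_sup K μ ν x

theorem finite_DomWeights (K : ℤ) : Finite (DomWeights (K, 0)) := by
  refine ((Set.finite_Icc ((0, 0) : Weight) (K, K)).subset fun ν hν => ?_).to_subtype
  rw [mem_DomWeights_iff] at hν
  simp only [Set.mem_Icc, Prod.le_def]
  omega

/-! ### Bijectivity of the action map. -/

section Action

variable {K : ℤ} (X : DomWeights (K, 0) → Type*) [∀ ν, AddCommGroup (X ν)]
  [∀ ν, Module Cq (X ν)] [∀ ν, Module U' (X ν)] [∀ ν, IsScalarTower Cq U' (X ν)]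

/-- The action of `U'` on a family of modules. -/
def actHom : U' →ₐ[Cq] ((ν : DomWeights (K, 0)) → Module.End Cq (X ν)) :=
  AlgHom.pi fun ν => Algebra.lsmul Cq Cq (X ν)

theorem actHom_apply (x : U') (ν : DomWeights (K, 0)) (w : X ν) : actHom X x ν w = x • w := rfl

variable {X} {v : ∀ ν, X ν} (hv : ∀ ν, IsHwVec ν.1 (v ν))
include hv

theorem actHom_eq_zero_of_mem_idealI {x : Udot} (hx : x ∈ idealI (K, 0)) :
    actHom X (x : U') = 0 := by
  let J : TwoSidedIdeal Udot := TwoSidedIdeal.mk' {y : Udot | actHom X (y : U') = 0}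
    (map_zero (actHom X))
    (fun {y z} hy hz => (map_add (actHom X) (y : U') z).trans (by rw [hy, hz, add_zero]))
    (fun {y} hy => (map_neg (actHom X) (y : U')).trans (by rw [hy, neg_zero]))
    (fun {y z} hz => (map_mul (actHom X) (y : U') z).trans (by rw [hz, mul_zero]))
    (fun {y z} hy => (map_mul (actHom X) (y : U') z).trans (by rw [hy, zero_mul]))
  have hJ : idealI (K, 0) ≤ J := by
    refine TwoSidedIdeal.span_le.2 ?_
    rintro _ ⟨μ, hμ, rfl⟩
    refine (TwoSidedIdeal.mem_mk' _ _ _ _ _ _ _).2 ?_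
    exact funext fun ν => LinearMap.ext fun w => (hv ν).one_smul_eq_zero ν.2 hμ w
  have hx' : x ∈ J := TwoSidedIdeal.le_iff.1 hJ hx
  exact (TwoSidedIdeal.mem_mk' {y : Udot | actHom X (y : U') = 0} _ _ _ _ _ x).1 hx'

theorem actHom_eq_zero {x : U'} (hx : x ∈ idealSub (K, 0)) : actHom X x = 0 := by
  obtain ⟨_, hx⟩ := hx
  exact actHom_eq_zero_of_mem_idealI hv hx

-- With `(k, l) = ν - i • α` and `m = ν₂`, `projElt k l m` kills all other modules and projects `X
-- ν` onto its `i`-th weight line. Then `F^(i') E^(i)` carries this line to the `i'`-th one, with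
-- the non-zero scalar `c`.
open Classical in
theorem exists_actHom_eq_single (ν : DomWeights (K, 0))
    (p : Fin ((ν.1.1 - ν.1.2).toNat + 1) × Fin ((ν.1.1 - ν.1.2).toNat + 1)) :
    ∃ x ∈ UdotSpan, actHom X x
      = Pi.single ν (Module.Basis.linearMap (hv ν).basis (hv ν).basis p) := by
  obtain ⟨i', i⟩ := p
  have hdom := mem_DomWeights_iff.1 ν.2
  have hi := i.2
  obtain ⟨k, hk⟩ := Int.eq_ofNat_of_zero_le (a := ν.1.1 - (i : ℕ)) (by omega)
  obtain ⟨l, hl⟩ := Int.eq_ofNat_of_zero_le (a := ν.1.2 + (i : ℕ)) (by omega)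
  obtain ⟨m, hm⟩ := Int.eq_ofNat_of_zero_le hdom.2.1
  have hK : K = (k : ℤ) + l := by omega
  have hw : ((k : ℤ), (l : ℤ)) = ν.1 - (i : ℕ) • α := by
    ext <;> simp [α] <;> omega
  set c := qBinom (ν.1.1 - ν.1.2).toNat i * qBinom i' i'
  have hc : c ≠ 0 := mul_ne_zero (qBinom_ne_zero _ _) (qBinom_ne_zero _ _)
  have hmem : Fdiv i' * Ediv i * projElt k l m ∈ UdotSpan := by
    have h : projElt k l m = projElt k l m * one ((k : ℤ), (l : ℤ)) := by
      simp only [projElt, Finset.sum_mul, smul_mul_assoc, mul_assoc, one_mul_one_self]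
    rw [h, ← mul_assoc]
    exact mul_one_mem _ _
  refine ⟨c⁻¹ • (Fdiv i' * Ediv i * projElt k l m), UdotSpan.smul_mem _ hmem, ?_⟩
  rw [map_smul, inv_smul_eq_iff₀ hc]
  refine funext fun ν' => (hv ν').basis.ext fun i₀ => ?_
  rw [actHom_apply, mul_smul, mul_smul,
    (hv ν').projElt_smul (by omega) (by omega) (hK ▸ ν'.2), Pi.smul_apply, LinearMap.smul_apply]
  by_cases hν : ν' = ν
  · subst hν
    rw [Pi.single_eq_same, if_pos hm, Module.Basis.linearMap_apply_apply, (hv ν').basis_apply,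
      (hv ν').one_smul_Fdiv_smul, hw]
    by_cases h : i = i₀
    · subst h
      have h1 := (hv ν').Ediv_smul_Fdiv_smul i 0 (by omega)
      have h2 := Fdiv_smul_Fdiv_smul (v ν') i' 0
      rw [add_zero] at h1 h2
      rw [if_pos rfl, if_pos rfl, h1, smul_comm (Fdiv i'), h2, smul_smul, (hv ν').basis_apply,
        Nat.sub_zero]
    · rw [if_neg, if_neg h, smul_zero, smul_zero, smul_zero]
      exact fun h' => h (Fin.ext (IsHwVec.weight_injective _ h'))
  · have hne : ν'.1.2 ≠ m := by
      intro h
      have hdom' := mem_DomWeights_iff.1 ν'.2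
      exact hν (Subtype.ext (Prod.ext (by omega) (by omega)))
    rw [if_neg hne, Pi.single_eq_of_ne hν, smul_zero, smul_zero, LinearMap.zero_apply, smul_zero]

theorem map_actHom_eq_top : UdotSpan.map (actHom X).toLinearMap = ⊤ := by
  classical
  have := finite_DomWeights K
  have := Fintype.ofFinite (DomWeights (K, 0))
  set R := UdotSpan.map (actHom X).toLinearMap
  have h1 : ∀ ν (f : Module.End Cq (X ν)), Pi.single ν f ∈ R := by
    intro ν f
    have h2 : (⊤ : Submodule Cq (Module.End Cq (X ν)))
        ≤ R.comap (LinearMap.single Cq (fun ν => Module.End Cq (X ν)) ν) := by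
      rw [← (Module.Basis.linearMap (hv ν).basis (hv ν).basis).span_eq, Submodule.span_le]
      rintro _ ⟨p, rfl⟩
      exact exists_actHom_eq_single hv ν p
    exact h2 (Submodule.mem_top (x := f))
  refine eq_top_iff.2 fun f _ => ?_
  rw [← Finset.univ_sum_single f]
  exact R.sum_mem fun ν _ => h1 ν (f ν)

/-- The images span by surjectivity, as the ideal acts by zero, and their number is the sum of the
squared dimensions. -/
theorem linearIndependent_actHom_spanElt :
    LinearIndependent Cq fun p : MatIndex K => actHom X (spanElt K p) := by
  have := finite_DomWeights K
  have := Fintype.ofFinite (DomWeights (K, 0))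
  have hfin : ∀ ν, Module.Finite Cq (X ν) := fun ν => .of_basis (hv ν).basis
  have hfree : ∀ ν, Module.Free Cq (X ν) := fun ν => .of_basis (hv ν).basis
  refine linearIndependent_of_top_le_span_of_card_eq_finrank ?_ ?_
  · rw [← map_actHom_eq_top hv]
    rintro _ ⟨x, hx, rfl⟩
    obtain ⟨s, hs, y, hy, rfl⟩ := Submodule.mem_sup.1 (Udot_le_span_sup K hx)
    rw [AlgHom.toLinearMap_apply, map_add, actHom_eq_zero hv hy, add_zero]
    have h := Submodule.mem_map_of_mem (f := (actHom X).toLinearMap) hs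
    rwa [Submodule.map_span, ← Set.range_comp] at h
  · rw [Module.finrank_pi_fintype, Fintype.card_sigma]
    refine Finset.sum_congr rfl fun ν _ => ?_
    rw [Module.finrank_linearMap, Module.finrank_eq_card_basis (hv ν).basis, Fintype.card_prod]

/-- Modulo the ideal, `x` is a combination of the `spanElt`; independence of their images makes its
coefficients zero. -/
theorem mem_idealI_of_actHom_eq_zero (x : Udot) (hx : actHom X x = 0) : x ∈ idealI (K, 0) := by
  have := finite_DomWeights K
  have := Fintype.ofFinite (DomWeights (K, 0))
  obtain ⟨s, hs, y, hy, hsy⟩ := Submodule.mem_sup.1 (Udot_le_span_sup K x.2)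
  rw [← hsy, map_add, actHom_eq_zero hv hy, add_zero] at hx
  obtain ⟨c, rfl⟩ := (Submodule.mem_span_range_iff_exists_fun Cq).1 hs
  simp only [map_sum, map_smul] at hx
  have hc := Fintype.linearIndependent_iff.1 (linearIndependent_actHom_spanElt hv) c hx
  rw [Finset.sum_eq_zero fun p _ => by rw [hc p, zero_smul], zero_add] at hsy
  obtain ⟨_, h⟩ := hy
  convert h
  exact hsy.symm

theorem exists_ringEquiv : ∃ Φ : UdotMod (K, 0) ≃+*
    ((ν : DomWeights (K, 0)) → Module.End Cq (X ν)),
    ∀ x : Udot, Φ (toUdotMod (K, 0) x) = actHom X x := by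
  let Φ : UdotMod (K, 0) →ₙ+* ((ν : DomWeights (K, 0)) → Module.End Cq (X ν)) :=
    { toFun := Quotient.lift (fun x : Udot => actHom X (x : U')) fun x y hxy => by
        have h := actHom_eq_zero_of_mem_idealI hv ((TwoSidedIdeal.rel_iff _ x y).1 hxy)
        exact sub_eq_zero.1 ((map_sub (actHom X) (x : U') y).symm.trans h)
      map_mul' := by
        rintro ⟨x⟩ ⟨y⟩
        exact map_mul (actHom X) (x : U') y
      map_zero' := map_zero (actHom X)
      map_add' := by
        rintro ⟨x⟩ ⟨y⟩
        exact map_add (actHom X) (x : U') y }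
  have hΦ : ∀ x : Udot, Φ (toUdotMod (K, 0) x) = actHom X x := fun _ => rfl
  refine ⟨RingEquiv.ofBijective Φ ⟨?_, ?_⟩, hΦ⟩
  · refine (injective_iff_map_eq_zero Φ).2 ?_
    rintro ⟨x⟩ hx
    exact (RingCon.eq _).2 (mem_idealI_of_actHom_eq_zero hv x hx)
  · intro f
    obtain ⟨x, hx, rfl⟩ := (map_actHom_eq_top hv).ge (Submodule.mem_top (x := f))
    exact ⟨toUdotMod (K, 0) ⟨x, hx⟩, rfl⟩

end Action

/-! ### The isomorphism and the idempotents. -/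

theorem exists_ringEquiv_projDot {k l m : ℕ} (hk : m ≤ k) (hl : m ≤ l)
    (X : DomWeights ((k : ℤ) + l, 0) → Type*) [∀ ν, AddCommGroup (X ν)]
    [∀ ν, Module Cq (X ν)] [∀ ν, Module U' (X ν)] [∀ ν, IsScalarTower Cq U' (X ν)]
    {v : ∀ ν, X ν} (hv : ∀ ν, IsHwVec ν.1 (v ν)) :
    ∃ Φ : UdotMod ((k : ℤ) + l, 0) ≃+*
        ((ν : DomWeights ((k : ℤ) + l, 0)) → Module.End Cq (X ν)),
      (∀ (x : Udot) (ν : DomWeights ((k : ℤ) + l, 0)) (w : X ν),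
        Φ (toUdotMod ((k : ℤ) + l, 0) x) ν w = (x : U') • w) ∧
      (∀ (ν : DomWeights ((k : ℤ) + l, 0)),
        ((ν : Weight) = ((k : ℤ) + l - m, (m : ℤ)) →
          ∀ w : X ν, Φ (toUdotMod ((k : ℤ) + l, 0) (projDot k l m)) ν w
            = one ((k : ℤ), (l : ℤ)) • w) ∧
        ((ν : Weight) ≠ ((k : ℤ) + l - m, (m : ℤ)) →
          Φ (toUdotMod ((k : ℤ) + l, 0) (projDot k l m)) ν = 0)) ∧
      IsIdempotentElem (toUdotMod ((k : ℤ) + l, 0) (projDot k l m)) := by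
  obtain ⟨Φ, hΦ⟩ := exists_ringEquiv hv
  have hact : ∀ (x : Udot) (ν : DomWeights ((k : ℤ) + l, 0)) (w : X ν),
      Φ (toUdotMod ((k : ℤ) + l, 0) x) ν w = (x : U') • w := fun x ν w => by
    rw [hΦ, actHom_apply]
  have hproj : ∀ (ν : DomWeights ((k : ℤ) + l, 0)) (w : X ν),
      Φ (toUdotMod ((k : ℤ) + l, 0) (projDot k l m)) ν w
        = if ν.1.2 = m then one ((k : ℤ), (l : ℤ)) • w else 0 := fun ν w => by
    rw [hact]
    exact (hv ν).projElt_smul hk hl ν.2 w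
  refine ⟨Φ, hact, fun ν => ⟨fun hν w => ?_, fun hν => LinearMap.ext fun w => ?_⟩, ?_⟩
  · rw [hproj, if_pos (by rw [hν])]
  · rw [hproj, if_neg, LinearMap.zero_apply]
    intro h
    have hdom := mem_DomWeights_iff.1 ν.2
    exact hν (Prod.ext (by dsimp only; omega) h)
  -- Idempotence is checked in each summand, where the element acts as the idempotent `1_(k,l)` or
  -- as 0.
  · refine Φ.injective ?_
    rw [map_mul]
    refine funext fun ν => LinearMap.ext fun w => ?_
    rw [Pi.mul_apply, Module.End.mul_apply, hproj, hproj]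
    split_ifs
    · rw [smul_smul, one_mul_one_self]
    · rfl

end QGL2

end

theorem mainTheorem11 (k l m : ℕ) (hk : m ≤ k) (hl : m ≤ l) :
    ∃ Φ : QGL2.UdotMod ((k : ℤ) + l, 0) ≃+*
        ((ν : QGL2.DomWeights ((k : ℤ) + l, 0)) → Module.End QGL2.Cq (QGL2.V ν)),
      (∀ (x : QGL2.Udot) (ν : QGL2.DomWeights ((k : ℤ) + l, 0)) (v : QGL2.V ν),
        Φ (QGL2.toUdotMod ((k : ℤ) + l, 0) x) ν v = (x : QGL2.U') • v) ∧
      (∀ (ν : QGL2.DomWeights ((k : ℤ) + l, 0)),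
        ((ν : QGL2.Weight) = ((k : ℤ) + l - m, (m : ℤ)) →
          ∀ v : QGL2.V ν, Φ (QGL2.toUdotMod ((k : ℤ) + l, 0) (QGL2.projDot k l m)) ν v
            = QGL2.one ((k : ℤ), (l : ℤ)) • v) ∧
        ((ν : QGL2.Weight) ≠ ((k : ℤ) + l - m, (m : ℤ)) →
          Φ (QGL2.toUdotMod ((k : ℤ) + l, 0) (QGL2.projDot k l m)) ν = 0)) ∧
      IsIdempotentElem (QGL2.toUdotMod ((k : ℤ) + l, 0) (QGL2.projDot k l m)) :=
  QGL2.exists_ringEquiv_projDot hk hl (fun ν => QGL2.V ν) fun ν =>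
    QGL2.isHwVec_mk (QGL2.mem_DomWeights_iff.1 ν.2).1
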